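/- \textbf{Conventions.} Indices are the positive integers. A coefficient function is a map $\epsilon:\mathbb N\to\mathbb N\cup\{0\}$, $\epsilon=(\epsilon_1,\epsilon_2,\dots)$; $\beta^i$ is the one with $\beta^i_i=1$ and $\beta^i_k=0$ for $k\ne i$. The order of $\epsilon\neq0$ is the smallest $n$ with $\epsilon_n\ne0$. For $J\subseteq\mathbb N$, $\epsilon|_J$ agrees with $\epsilon$ on $J$ and vanishes elsewhere. Coefficient functions are ordered lexicographically: $\epsilon<\epsilon'$ if for some $k$ we have $\epsilon_j=\epsilon'_j$ for $j<k$ and $\epsilon_k<\epsilon'_k$; in a set $S$ of coefficient functions, the immediate successor (predecessor) of $\delta$ is the smallest (largest) member of $S$ that is greater (less) than $\delta$. For a real sequence $Q=(Q_1,Q_2,\dots)$ put $\sum\epsilon Q=\sum_{k\ge1}\epsilon_kQ_k$. Decreasing means strictly decreasing. For a set $\mathcal E$ of coefficient functions let $\mathcal E^M=\{\epsilon|_{[1,M]}:\epsilon\in\mathcal E\}$. A set $\mathcal E$ containing $0$ and all $\beta^i$ is called \emph{Zeckendorf for $(0,1)$} if: (i) for all $M\ge 1$, every $\mu\in\mathcal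 E^M$ has only finitely many smaller elements in $\mathcal E^M$; (ii) for each $n\ge1$ there is a unique coefficient function $\bar\beta^n$ of order $n$ with infinite support, called the maximal coefficient function of order $n$, such that for all $M\ge n$, $\bar\beta^n|_{[1,M]}$ is the immediate predecessor of $\beta^{n-1}|_{[1,M]}$ in $\mathcal E^M$ if $n\ge2$, and the largest element of $\mathcal E^M$ if $n=1$; (iii) for all $M\ge1$ and $\mu\in\mathcal E^M$ with $\mu<\bar\beta^1|_{[1,M]}$, if the immediate successor $\tilde\mu$ of $\mu$ in $\mathcal E^M$ is not $\mu+\beta^M$, then there is $1\le n<M$ with $\bar\beta^{n+1}_k=\mu_k$ for $n<k\le M$ and $\tilde\mu=\mu|_{[1,n]}+\beta^n$; (iv) a coefficient function $\epsilon$ belongs to $\mathcal E$ if and only if for infinitely many $M\ge1$ we have $\epsilon|_{[1,M]}\in\mathcal E^M$ and the immediate successor of $\epsilon|_{[1,M]}$ in $\mathcal E^M$ is $(\epsilon+\beta^M)|_{[1,M]}$. A sequence $Q$ in $(0,1)$ is a \emph{fundamental sequence for $(0,1)$ under $\mathcal E$} if the sums $\sum\delta Q$, $\delta\in\mathcal E$,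 converge and have distinct values, and $\{\sum\delta Q:0\ne\delta\in\mathcal E\}=(0,1)$. \textbf{Theorem.} (1) Let $Q$ be a decreasing sequence in $(0,1)$, and put $Q_0=1$. (a) If $Q_n\to0$, then there are coefficient functions $\mu^n$ of order $n$ with infinite support, $n\ge1$, such that $Q_{n-1}=\sum\mu^nQ$ for all $n\ge1$. (b) Let $\mathcal E$ be Zeckendorf for $(0,1)$ with maximal coefficient functions $\bar\beta^n$, $n\ge1$. Then $Q$ is a fundamental sequence for $(0,1)$ under $\mathcal E$ if and only if $Q_{n-1}=\sum\bar\beta^nQ$ for all $n\ge1$. (2) Let $N\ge1$ and let $L=(e_1,\dots,e_N)\ne(1)$ be a list of non-negative integers with $e_1e_N>0$. For $n\ge1$ let $\bar\beta^n=(0,\dots,0,e_1,\dots,e_{N-1},e_N-1,e_1,\dots,e_{N-1},e_N-1,\dots)$, which starts at index $n$ and repeats with period $N$. Let $\mathcal L$ be the collection determined by these, that is, the set of all sums $\sum_{m\ge1}\zeta^m$ for which there are indices $n_m\le i_m$ with $n_1=1$, $n_{m+1}=i_m+1$, such that $\zeta^m_k=\bar\beta^{n_m}_k$ for $n_m\le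 k<i_m$, $0\le\zeta^m_{i_m}<\bar\beta^{n_m}_{i_m}$, and $\zeta^m_k=0$ for $k\notin[n_m,i_m]$. Then the polynomial $e_Nx^N+\cdots+e_1x-1$ has exactly one positive real zero $\omega$, there is a fundamental sequence for $(0,1)$ under $\mathcal L$, and the one and only decreasing one is $Q_k=\omega^k$, $k\ge1$. -/

import Mathlib

/-- Coefficient functions `ε = (ε₁, ε₂, …)`; indices are the positive integers.
The descending lexicographical order is the order of `Lex (ℕ+ → ℕ)`, reached through `toLex`. -/
abbrev Coeff : Type := ℕ+ → ℕ

namespace Coeff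

/-- The basis coefficient function `β^i`. -/
def basis (i : ℕ+) : Coeff := fun k => if k = i then 1 else 0

/-- The restriction of `ε` to the indices `1, …, M`. -/
def res (M : ℕ+) (ε : Coeff) : Coeff := fun k => if k ≤ M then ε k else 0

/-- `ε` is non-zero and `n` is the smallest index with `ε_n ≠ 0`. -/
def HasOrder (ε : Coeff) (n : ℕ+) : Prop := IsLeast {k : ℕ+ | ε k ≠ 0} n

/-- `ε` does not have a finite support. -/
def InfSupport (ε : Coeff) : Prop := {k : ℕ+ | ε k ≠ 0}.Infinite

/-- `ν` is the smallest member of `S` that is greater than `δ`. -/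
def IsImmSucc (S : Set Coeff) (δ ν : Coeff) : Prop :=
  ν ∈ S ∧ toLex δ < toLex ν ∧ ∀ x ∈ S, toLex δ < toLex x → toLex ν ≤ toLex x

/-- `ν` is the largest member of `S` that is less than `δ`. -/
def IsImmPred (S : Set Coeff) (δ ν : Coeff) : Prop :=
  ν ∈ S ∧ toLex ν < toLex δ ∧ ∀ x ∈ S, toLex x < toLex δ → toLex x ≤ toLex ν

/-- The collection `𝓔^M` of the restrictions to `[1, M]` of the members of `𝓔`. -/
def trunc (E : Set Coeff) (M : ℕ+) : Set Coeff := res M '' E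

/-- `b` is a maximal coefficient function of order `n` for `E`: it has order `n` and infinite
support, and, for all `M ≥ n`, its restriction to `[1, M]` is the largest member of `𝓔^M` if
`n = 1`, and the immediate predecessor of (the restriction of) `β^{n-1}` in `𝓔^M` if `n ≥ 2`. -/
structure IsMaximal (E : Set Coeff) (n : ℕ+) (b : Coeff) : Prop where
  order : HasOrder b n
  infinite : InfSupport b
  first : n = 1 → ∀ M : ℕ+, res M b ∈ trunc E M ∧ ∀ x ∈ trunc E M, toLex x ≤ toLex (res M b)
  pred : ∀ m : ℕ+, n = m + 1 → ∀ M : ℕ+, n ≤ M →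
    IsImmPred (trunc E M) (res M (basis m)) (res M b)

/-- Zeckendorf collections of coefficient functions for the open unit interval. -/
structure IsZeckendorf (E : Set Coeff) : Prop where
  zero_mem : (0 : Coeff) ∈ E
  basis_mem : ∀ i : ℕ+, basis i ∈ E
  finite_below : ∀ M : ℕ+, ∀ μ ∈ trunc E M, {x ∈ trunc E M | toLex x < toLex μ}.Finite
  maximal : ∀ n : ℕ+, ∃! b : Coeff, IsMaximal E n b
  succ_form : ∀ b : ℕ+ → Coeff, (∀ n, IsMaximal E n (b n)) →
    ∀ M : ℕ+, ∀ μ ∈ trunc E M, toLex μ < toLex (res M (b 1)) →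
      ∀ ν : Coeff, IsImmSucc (trunc E M) μ ν → ν ≠ μ + basis M →
        ∃ n : ℕ+, n < M ∧ (∀ k : ℕ+, n < k → k ≤ M → b (n + 1) k = μ k) ∧
          ν = res n μ + basis n
  mem_iff : ∀ ε : Coeff, ε ∈ E ↔
    {M : ℕ+ | res M ε ∈ trunc E M ∧
      IsImmSucc (trunc E M) (res M ε) (res M (ε + basis M))}.Infinite

/-- `ζ` is a proper `δ`-block at index `n` with support `[n, i]`. -/
structure IsProperBlock (δ : ℕ+ → Coeff) (n i : ℕ+) (ζ : Coeff) : Prop where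
  le : n ≤ i
  last_lt : ζ i < δ n i
  eq_before : ∀ k : ℕ+, n ≤ k → k < i → ζ k = δ n k
  eq_zero : ∀ k : ℕ+, (k < n ∨ i < k) → ζ k = 0

/-- The collection determined by `δ¹, δ², …`: all sums `∑_{m ≥ 1} ζ^m` of proper `δ`-blocks with
supports `[n_m, i_m]` such that `n_1 = 1` and `n_{m+1} = i_m + 1`. At every index at most one
`ζ^m` is non-zero. -/
def determinedBy (δ : ℕ+ → Coeff) : Set Coeff :=
  {ε | ∃ (ζ : ℕ+ → Coeff) (n i : ℕ+ → ℕ+),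
    n 1 = 1 ∧ (∀ m, n (m + 1) = i m + 1) ∧ (∀ m, IsProperBlock δ (n m) (i m) (ζ m)) ∧
    ∀ k, ε k = ∑ᶠ m, ζ m k}

/-- For the list `(e_1, …, e_N)`, the coefficient functions
`β̄^n = (0, …, 0, e_1, e_2, …, e_{N-1}, e_N - 1, e_1, e_2, …)`, periodic from index `n` on.
Only the values `e 1, …, e N` are used. -/
def listMax (N : ℕ) (e : ℕ → ℕ) (n : ℕ+) : Coeff := fun k =>
  if k < n then 0
  else
    let r := ((k : ℕ) - (n : ℕ)) % N + 1
    if r = N then e N - 1 else e r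

/-- The sequence `Q` prolonged by `Q_0 = 1`. -/
noncomputable def withOne (Q : ℕ+ → ℝ) (k : ℕ) : ℝ := if h : 0 < k then Q ⟨k, h⟩ else 1

/-- The value `∑ ε Q = ∑_{k ≥ 1} ε_k Q_k`. -/
noncomputable def value (Q : ℕ+ → ℝ) (ε : Coeff) : ℝ := ∑' k : ℕ+, (ε k : ℝ) * Q k

/-- The unique `𝓔`-representation property: the sums `∑ δ Q`, `δ ∈ 𝓔`, converge and have
distinct values. -/
def UniqueRep (E : Set Coeff) (Q : ℕ+ → ℝ) : Prop :=
  (∀ δ ∈ E, Summable fun k : ℕ+ => (δ k : ℝ) * Q k) ∧ Set.InjOn (value Q) E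

/-- The set of the values `∑ δ Q` for non-zero `δ ∈ 𝓔`. -/
def valueSet (E : Set Coeff) (Q : ℕ+ → ℝ) : Set ℝ := value Q '' (E \ {0})

/-- `Q` is a fundamental sequence, with terms in `(0, 1)`, for the `𝓔`-subset `Y` of `(0, 1)`. -/
def IsFundamental (E : Set Coeff) (Y : Set ℝ) (Q : ℕ+ → ℝ) : Prop :=
  (∀ k, Q k ∈ Set.Ioo (0 : ℝ) 1) ∧ UniqueRep E Q ∧ valueSet E Q = Y

/-- `Q_{n-1} = ∑ μ^n Q` for all `n ≥ 1`, where `Q_0 = 1`; the series converge. -/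
def FullRecursion (μ : ℕ+ → Coeff) (Q : ℕ+ → ℝ) : Prop :=
  ∀ n : ℕ+, HasSum (fun k : ℕ+ => (μ n k : ℝ) * Q k) (withOne Q ((n : ℕ) - 1))

end Coeff

/-! A member is read digit by digit: the maximal function `b n` of the current block, begun at `n`,
caps each digit, and a digit below its cap closes the block. The maximal functions thus determine
the collection, and the theorem becomes a comparison of sums with weights `q`, where `q 0 = 1`.

If each `b n` has value `q n`, the tail of a member after a closed block is worth less than one unit
of the last digit. Hence values increase strictly in the lexicographical order (`val_lt_val`) and
stay below 1, and the greedy expansion reaches every number in `[0, 1)` (`val_greedy`). Conversely,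
under a fundamental sequence, a `b n` worth more than `q n` would yield a forbidden representation
of `q n` (`IsFund.psum_le`); if it were worth less, its value would be that of a member, which must
be worth strictly less (`IsFund.hasSum`).

The Zeckendorf axioms enter through `IsZeckendorf.eq_determinedBy`: the digits that may follow a
prefix are exactly those from 0 to the cap. Part (1a) takes at each index the largest digit that
leaves a positive remainder. In part (2) the full recursion amounts to a linear recursion of order
`N`; division by `ω ^ n` turns it into a mean value recursion, whose non-negative solutions are
constant (`eq_const_of_mean`). -/

/-! Collections of coefficient functions indexed from `0`, read digit by digit: `b n` is the maximal
function of a block that begins at the index `n`. -/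

/-! ### Block structure of digit sequences -/

namespace BlockLang

/-- The index at which the block of `ε` that contains the index `k` begins. -/
def start (b : ℕ → ℕ → ℕ) (ε : ℕ → ℕ) : ℕ → ℕ
  | 0 => 0
  | k + 1 => if ε k < b (start b ε k) k then k + 1 else start b ε k

/-- The sequences all of whose blocks are proper, and of which there are infinitely many. -/
def lang (b : ℕ → ℕ → ℕ) : Set (ℕ → ℕ) :=
  {ε | (∀ k, ε k ≤ b (start b ε k) k) ∧ ∀ m, ∃ k, m ≤ k ∧ ε k < b (start b ε k) k}

/-- `b n` begins at the index `n` and has infinite support. -/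
structure IsProper (b : ℕ → ℕ → ℕ) : Prop where
  zero_before : ∀ n k, k < n → b n k = 0
  pos : ∀ n, 0 < b n n
  exists_pos : ∀ n m, ∃ k, m ≤ k ∧ 0 < b n k

/-- The partial sum over the indices below `m`; the weight of the index `k` is `q (k + 1)`. -/
noncomputable def psum (q : ℕ → ℝ) (ε : ℕ → ℕ) (m : ℕ) : ℝ :=
  ∑ k ∈ Finset.range m, (ε k : ℝ) * q (k + 1)

/-- The value of a sequence. -/
noncomputable def val (q : ℕ → ℝ) (ε : ℕ → ℕ) : ℝ := ∑' k, (ε k : ℝ) * q (k + 1)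

variable {b : ℕ → ℕ → ℕ} {q : ℕ → ℝ} {ε η : ℕ → ℕ}

lemma psum_succ (m : ℕ) : psum q ε (m + 1) = psum q ε m + ε m * q (m + 1) :=
  Finset.sum_range_succ _ _

lemma psum_congr {m : ℕ} (h : ∀ k < m, ε k = η k) : psum q ε m = psum q η m :=
  Finset.sum_congr rfl fun k hk => by rw [h k (Finset.mem_range.1 hk)]

lemma psum_eq_zero {m : ℕ} (h : ∀ k < m, ε k = 0) : psum q ε m = 0 :=
  Finset.sum_eq_zero fun k hk => by rw [h k (Finset.mem_range.1 hk)]; simp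

lemma psum_mono (hq : ∀ k, 0 < q k) : Monotone (psum q ε) :=
  monotone_nat_of_le_succ fun m => by
    rw [psum_succ]
    have := hq (m + 1)
    have : 0 ≤ (ε m : ℝ) * q (m + 1) := by positivity
    linarith

lemma psum_le_val (hq : ∀ k, 0 < q k) (hs : Summable fun k => (ε k : ℝ) * q (k + 1)) (m : ℕ) :
    psum q ε m ≤ val q ε :=
  hs.sum_le_tsum _ fun _ _ => mul_nonneg (Nat.cast_nonneg _) (hq _).le

lemma summable_of_psum_le (hq : ∀ k, 0 < q k) {c : ℝ} (h : ∀ m, psum q ε m ≤ c) :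
    (Summable fun k => (ε k : ℝ) * q (k + 1)) ∧ val q ε ≤ c := by
  have h0 : ∀ k, 0 ≤ (ε k : ℝ) * q (k + 1) := fun k =>
    mul_nonneg (Nat.cast_nonneg _) (hq _).le
  have hs := summable_of_sum_range_le h0 h
  exact ⟨hs, hs.tsum_le_of_sum_range_le h⟩

/-- A block maximum exceeds each of its partial sums. -/
lemma exists_psum_lt (hb : IsProper b) (hq : ∀ k, 0 < q k) (n m : ℕ) :
    ∃ k, psum q (b n) m < psum q (b n) k := by
  obtain ⟨k, hk, hpos⟩ := hb.exists_pos n m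
  refine ⟨k + 1, (psum_mono hq hk).trans_lt ?_⟩
  rw [psum_succ]
  have := hq (k + 1)
  have h2 : (0 : ℝ) < b n k := by exact_mod_cast hpos
  have : 0 < (b n k : ℝ) * q (k + 1) := by positivity
  linarith

lemma start_succ_of_lt {k : ℕ} (h : ε k < b (start b ε k) k) : start b ε (k + 1) = k + 1 := by
  simp [start, h]

lemma start_succ_of_not_lt {k : ℕ} (h : ¬ ε k < b (start b ε k) k) :
    start b ε (k + 1) = start b ε k := by
  simp [start, h]

lemma start_congr {m : ℕ} (h : ∀ k < m, ε k = η k) : start b ε m = start b η m := by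
  induction m with
  | zero => rfl
  | succ m ih =>
    simp only [start]
    rw [ih fun k hk => h k (by omega), h m (by omega)]

lemma start_congr_of_le {m : ℕ} (h : ∀ k, m ≤ k → ε k = η k) (hm : start b ε m = start b η m)
    {k : ℕ} (hk : m ≤ k) : start b ε k = start b η k := by
  induction k, hk using Nat.le_induction with
  | base => exact hm
  | succ k hk ih =>
    simp only [start]
    rw [ih, h k hk]

lemma start_of_zero (hb : IsProper b) {n : ℕ} (h : ∀ k < n, ε k = 0) {k : ℕ} (hk : k ≤ n) :
    start b ε k = k := by
  induction k with
  | zero => rfl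
  | succ k ih =>
    apply start_succ_of_lt
    rw [ih (by omega), h k (by omega)]
    exact hb.pos k

lemma start_of_eq {n m : ℕ} (hn : start b ε n = n) (h : ∀ k, n ≤ k → k < m → ε k = b n k)
    {k : ℕ} (hk : n ≤ k) (hkm : k ≤ m) : start b ε k = n := by
  induction k, hk using Nat.le_induction with
  | base => exact hn
  | succ k hk ih =>
    have ih := ih (by omega)
    rw [start_succ_of_not_lt, ih]
    rw [ih, h k hk (by omega)]
    exact lt_irrefl _

/-- An admissible sequence that vanishes eventually belongs to the collection. -/
lemma mem_lang_of_finite (hb : IsProper b) (h : ∀ k, ε k ≤ b (start b ε k) k) {M : ℕ}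
    (hM : ∀ k, M ≤ k → ε k = 0) : ε ∈ lang b := by
  refine ⟨h, fun m => ?_⟩
  by_contra! hc
  have hst : ∀ k, max m M ≤ k → start b ε k = start b ε (max m M) := by
    intro k hk
    induction k, hk using Nat.le_induction with
    | base => rfl
    | succ k hk ih => rw [start_succ_of_not_lt (not_lt.2 (hc k (by omega))), ih]
  obtain ⟨k, hk, hpos⟩ := hb.exists_pos (start b ε (max m M)) (max m M)
  have := hc k (by omega)
  rw [hst k hk, hM k (by omega)] at this
  omega

lemma zero_mem_lang (hb : IsProper b) : (0 : ℕ → ℕ) ∈ lang b :=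
  mem_lang_of_finite hb (M := 0) (fun _ => Nat.zero_le _) fun _ _ => rfl

lemma single_mem_lang (hb : IsProper b) (n : ℕ) : (Pi.single n 1 : ℕ → ℕ) ∈ lang b := by
  have hz : ∀ k, k ≠ n → (Pi.single n 1 : ℕ → ℕ) k = 0 := fun k hk => by simp [hk]
  refine mem_lang_of_finite hb (M := n + 1) (fun k => ?_) fun k hk => hz k (by omega)
  by_cases hk : k = n
  · subst hk
    rw [start_of_zero hb (fun j hj => hz j (by omega)) le_rfl]
    simpa using Nat.one_le_iff_ne_zero.2 (hb.pos k).ne'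
  · rw [hz k hk]; exact Nat.zero_le _

/-- Replacing the initial part of a member whose block begins at `m`. -/
lemma mem_lang_of_tail {m : ℕ} (hη : η ∈ lang b) (hε : ∀ k < m, ε k ≤ b (start b ε k) k)
    (h : ∀ k, m ≤ k → ε k = η k) (hm : start b ε m = start b η m) : ε ∈ lang b := by
  refine ⟨fun k => ?_, fun j => ?_⟩
  · rcases lt_or_ge k m with hk | hk
    · exact hε k hk
    · rw [start_congr_of_le h hm hk, h k hk]
      exact hη.1 k
  · obtain ⟨k, hk, hlt⟩ := hη.2 (max j m)
    refine ⟨k, by omega, ?_⟩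
    rwa [start_congr_of_le h hm (by omega : m ≤ k), h k (by omega)]

/-! ### Upper bounds for tails, and monotonicity of the value -/

section Bounds

variable {d : ℕ → ℝ}

/-- The partial sum plus what the current block still allows never increases. -/
lemma psum_add_remaining_succ_le (hb : IsProper b) (hq : ∀ k, 0 < q k)
    (hd : ∀ n m, psum q (b n) m ≤ d n) (hdq : ∀ n, d n ≤ q n)
    (hε : ∀ k, ε k ≤ b (start b ε k) k) (m : ℕ) :
    (psum q ε (m + 1) + (d (start b ε (m + 1)) - psum q (b (start b ε (m + 1))) (m + 1)) ≤
      psum q ε m + (d (start b ε m) - psum q (b (start b ε m)) m)) ∧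
    (ε m < b (start b ε m) m →
      psum q ε (m + 1) + (d (start b ε (m + 1)) - psum q (b (start b ε (m + 1))) (m + 1)) <
      psum q ε m + (d (start b ε m) - psum q (b (start b ε m)) m)) := by
  by_cases h : ε m < b (start b ε m) m
  · suffices H : psum q ε (m + 1) +
        (d (start b ε (m + 1)) - psum q (b (start b ε (m + 1))) (m + 1)) <
        psum q ε m + (d (start b ε m) - psum q (b (start b ε m)) m) from ⟨H.le, fun _ => H⟩
    rw [start_succ_of_lt h, psum_eq_zero (hb.zero_before (m + 1)), psum_succ]
    -- A digit below its cap frees at least `q (m + 1)`, which pays for a new block. Infinite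
    -- support leaves the old maximum a positive tail, so the drop is strict.
    obtain ⟨k, hk⟩ := exists_psum_lt hb hq (start b ε m) (m + 1)
    have h1 := hd (start b ε m) k
    rw [psum_succ] at hk
    have h2 : ((ε m : ℝ) + 1) * q (m + 1) ≤ b (start b ε m) m * q (m + 1) :=
      mul_le_mul_of_nonneg_right (by exact_mod_cast h) (hq _).le
    have h3 := hdq (m + 1)
    linarith
  · refine ⟨?_, fun h' => absurd h' h⟩
    rw [start_succ_of_not_lt h, psum_succ, psum_succ, le_antisymm (hε m) (not_lt.1 h)]
    linarith

/-- The part of a member from the beginning of a block on has a value less than the bound of the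
block maxima. -/
lemma summable_and_val_lt (hb : IsProper b) (hq : ∀ k, 0 < q k)
    (hd : ∀ n m, psum q (b n) m ≤ d n) (hdq : ∀ n, d n ≤ q n) (hε : ε ∈ lang b) {m : ℕ}
    (hm : start b ε m = m) :
    (Summable fun k => (ε k : ℝ) * q (k + 1)) ∧ val q ε < psum q ε m + d m := by
  set F : ℕ → ℝ := fun m => psum q ε m + (d (start b ε m) - psum q (b (start b ε m)) m) with hF
  have hstep := psum_add_remaining_succ_le hb hq hd hdq hε.1
  have hanti : Antitone F := antitone_nat_of_succ_le fun m => (hstep m).1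
  obtain ⟨k, hmk, hk⟩ := hε.2 m
  -- Fixing one strict drop keeps the inequality strict after the passage to the limit.
  have hlt : F (k + 1) < psum q ε m + d m := by
    refine ((hstep k).2 hk).trans_le ((hanti hmk).trans ?_)
    simp only [hF]
    rw [hm, psum_eq_zero (hb.zero_before m)]
    linarith
  have hbound : ∀ j, psum q ε j ≤ F (k + 1) := fun j => by
    refine (psum_mono hq (le_max_left j (k + 1))).trans
      (le_trans ?_ (hanti (le_max_right j (k + 1))))
    have := hd (start b ε (max j (k + 1))) (max j (k + 1))
    simp only [hF]
    linarith
  obtain ⟨hs, hv⟩ := summable_of_psum_le hq hbound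
  exact ⟨hs, hv.trans_lt hlt⟩

/-- The value is strictly increasing for the lexicographical order. -/
lemma val_lt_val (hb : IsProper b) (hq : ∀ k, 0 < q k) (hS : ∀ n m, psum q (b n) m ≤ q n)
    (hε : ε ∈ lang b) (hη : η ∈ lang b) {m : ℕ} (h : ∀ k < m, ε k = η k) (hm : ε m < η m) :
    val q ε < val q η := by
  have hst := start_congr (b := b) h
  -- The smaller digit closes its block, so the tail of `ε` after `m` is worth less than one unit at
  -- `m`.
  have h1 := start_succ_of_lt (hm.trans_le (hst ▸ hη.1 m))
  have h2 := (summable_and_val_lt hb hq hS (fun _ => le_rfl) hε h1).2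
  have h3 := psum_le_val hq (summable_and_val_lt hb hq hS (fun _ => le_rfl) hη (m := 0) rfl).1
    (m + 1)
  rw [psum_succ] at h2 h3
  rw [psum_congr h] at h2
  have h4 : ((ε m : ℝ) + 1) * q (m + 1) ≤ η m * q (m + 1) :=
    mul_le_mul_of_nonneg_right (by exact_mod_cast hm) (hq _).le
  linarith

lemma injOn_val (hb : IsProper b) (hq : ∀ k, 0 < q k) (hS : ∀ n m, psum q (b n) m ≤ q n) :
    Set.InjOn (val q) (lang b) := by
  intro ε hε η hη h
  by_contra hne
  have hex : ∃ m, ε m ≠ η m := Function.ne_iff.1 hne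
  classical
  have hbefore : ∀ k < Nat.find hex, ε k = η k := fun k hk => not_not.1 (Nat.find_min hex hk)
  rcases lt_or_gt_of_ne (Nat.find_spec hex) with h1 | h1
  · exact (val_lt_val hb hq hS hε hη hbefore h1).ne h
  · exact (val_lt_val hb hq hS hη hε (fun k hk => (hbefore k hk).symm) h1).ne h.symm

end Bounds

/-! ### Greedy expansions under the full recursion -/

section Greedy

/-- The digit chosen at the index `k`, when the block begins at `s.1` and `s.2` is left. -/
noncomputable def greedyDigit (b : ℕ → ℕ → ℕ) (q : ℕ → ℝ) (k : ℕ) (s : ℕ × ℝ) : ℕ :=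
  min ⌊s.2 / q (k + 1)⌋₊ (b s.1 k)

/-- The beginning of the current block and the remainder in the greedy expansion of `x`. -/
noncomputable def greedyState (b : ℕ → ℕ → ℕ) (q : ℕ → ℝ) (x : ℝ) : ℕ → ℕ × ℝ
  | 0 => (0, x)
  | k + 1 =>
    (if greedyDigit b q k (greedyState b q x k) < b (greedyState b q x k).1 k then k + 1
      else (greedyState b q x k).1,
     (greedyState b q x k).2 - greedyDigit b q k (greedyState b q x k) * q (k + 1))

/-- The greedy expansion of `x`. -/
noncomputable def greedy (b : ℕ → ℕ → ℕ) (q : ℕ → ℝ) (x : ℝ) (k : ℕ) : ℕ :=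
  greedyDigit b q k (greedyState b q x k)

lemma start_greedy (x : ℝ) (k : ℕ) : start b (greedy b q x) k = (greedyState b q x k).1 := by
  induction k with
  | zero => rfl
  | succ k ih => simp only [start, greedyState, ih]; rfl

lemma psum_greedy (x : ℝ) (k : ℕ) : psum q (greedy b q x) k + (greedyState b q x k).2 = x := by
  induction k with
  | zero => simp [psum, greedyState]
  | succ k ih =>
    rw [psum_succ]
    simp only [greedyState]
    change _ + (greedy b q x k : ℝ) * _ + (_ - (greedy b q x k : ℝ) * _) = x
    linarith

/-- The remainder stays below what the current block can still spend. A digit equal to the cap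
lowers both sides equally; a digit below the cap is a true floor, which leaves less than `q (k +
1)`, the budget of the block that opens next. -/
lemma greedyState_bounds (hb : IsProper b) (hq : ∀ k, 0 < q k) {x : ℝ} (hx : 0 ≤ x)
    (hx1 : x < q 0) (k : ℕ) :
    0 ≤ (greedyState b q x k).2 ∧ (greedyState b q x k).2 <
      q (greedyState b q x k).1 - psum q (b (greedyState b q x k).1) k := by
  induction k with
  | zero => simpa [greedyState, psum] using ⟨hx, hx1⟩
  | succ k ih =>
    obtain ⟨h0, h1⟩ := ih
    simp only [greedyState]
    set s := greedyState b q x k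
    have hqk := hq (k + 1)
    have hfl : (greedyDigit b q k s : ℝ) * q (k + 1) ≤ s.2 := by
      rw [← le_div_iff₀ hqk]
      refine le_trans ?_ (Nat.floor_le (div_nonneg h0 hqk.le))
      exact_mod_cast min_le_left _ _
    refine ⟨by linarith, ?_⟩
    split_ifs with h
    · rw [psum_eq_zero (hb.zero_before (k + 1))]
      have : greedyDigit b q k s = ⌊s.2 / q (k + 1)⌋₊ := by
        unfold greedyDigit at h ⊢
        omega
      have h2 := Nat.lt_floor_add_one (s.2 / q (k + 1))
      rw [div_lt_iff₀ hqk, ← this] at h2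
      linarith
    · have : greedyDigit b q k s = b s.1 k := by
        unfold greedyDigit at h ⊢
        omega
      rw [this, psum_succ]
      linarith

/-- If no digit from `m` on were below its cap, the remainder at `m` would cover the whole tail of
`b n`, against the strict bound in `greedyState_bounds`. -/
lemma greedy_mem_lang (hb : IsProper b) (hq : ∀ k, 0 < q k)
    (hD : ∀ n, HasSum (fun k => (b n k : ℝ) * q (k + 1)) (q n)) {x : ℝ} (hx : 0 ≤ x)
    (hx1 : x < q 0) : greedy b q x ∈ lang b := by
  refine ⟨fun k => ?_, fun m => ?_⟩
  · rw [start_greedy]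
    exact min_le_right _ _
  by_contra! hc
  have hst : ∀ k, m ≤ k → start b (greedy b q x) k = start b (greedy b q x) m := by
    intro k hk
    induction k, hk using Nat.le_induction with
    | base => rfl
    | succ k hk ih => rw [start_succ_of_not_lt (not_lt.2 (hc k hk)), ih]
  set n := start b (greedy b q x) m with hn
  have hkey : ∀ k, m ≤ k →
      psum q (b n) k - psum q (b n) m ≤ psum q (greedy b q x) k - psum q (greedy b q x) m := by
    intro k hk
    induction k, hk using Nat.le_induction with
    | base => simp
    | succ k hk ih =>
      rw [psum_succ, psum_succ]
      have h1 := hc k hk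
      rw [hst k hk] at h1
      have : (b n k : ℝ) * q (k + 1) ≤ greedy b q x k * q (k + 1) :=
        mul_le_mul_of_nonneg_right (by exact_mod_cast h1) (hq _).le
      linarith
  have hle : q n ≤ psum q (b n) m + (greedyState b q x m).2 := by
    refine le_of_tendsto (hD n).tendsto_sum_nat ?_
    filter_upwards [Filter.eventually_ge_atTop m] with k hk
    change psum q (b n) k ≤ _
    have h1 := hkey k hk
    have h2 := psum_greedy (b := b) (q := q) x k
    have h3 := psum_greedy (b := b) (q := q) x m
    have h4 := (greedyState_bounds hb hq hx hx1 k).1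
    linarith
  have h5 := (greedyState_bounds hb hq hx hx1 m).2
  rw [← start_greedy (b := b) (q := q) x m, ← hn] at h5
  linarith

/-- The terms of the series tend to 0, and the digits of `b 0` are at least 1 infinitely often;
monotonicity does the rest. -/
lemma tendsto_zero_of_hasSum (hb : IsProper b) (hq : ∀ k, 0 < q k) (hanti : Antitone q)
    (hD : Summable fun k => (b 0 k : ℝ) * q (k + 1)) :
    Filter.Tendsto q Filter.atTop (nhds 0) := by
  rw [Metric.tendsto_atTop]
  intro r hr
  obtain ⟨M, hM⟩ := Filter.eventually_atTop.1 (hD.tendsto_atTop_zero.eventually (gt_mem_nhds hr))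
  obtain ⟨k, hk, hpos⟩ := hb.exists_pos 0 M
  refine ⟨k + 1, fun j hj => ?_⟩
  rw [Real.dist_eq, sub_zero, abs_of_pos (hq j)]
  have h1 := hM k hk
  have h2 : (1 : ℝ) ≤ b 0 k := by exact_mod_cast hpos
  have h3 := hanti hj
  have h4 := hq (k + 1)
  nlinarith

/-- Each time a block closes at `k`, the remainder falls below `q (k + 1)`; this happens infinitely
often, with weights tending to 0. -/
lemma val_greedy (hb : IsProper b) (hq : ∀ k, 0 < q k) (hanti : Antitone q)
    (hD : ∀ n, HasSum (fun k => (b n k : ℝ) * q (k + 1)) (q n)) {x : ℝ} (hx : 0 ≤ x)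
    (hx1 : x < q 0) : val q (greedy b q x) = x := by
  have hmem := greedy_mem_lang hb hq hD hx hx1
  have hle : ∀ m, psum q (greedy b q x) m ≤ x := fun m => by
    have := psum_greedy (b := b) (q := q) x m
    have := (greedyState_bounds hb hq hx hx1 m).1
    linarith
  obtain ⟨hs, hv⟩ := summable_of_psum_le hq hle
  refine le_antisymm hv (le_of_forall_pos_le_add fun r hr => ?_)
  have h0 := tendsto_zero_of_hasSum hb hq hanti (hD 0).summable
  obtain ⟨M, hM⟩ := Filter.eventually_atTop.1 (h0.eventually (gt_mem_nhds hr))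
  obtain ⟨k, hk, hlt⟩ := hmem.2 M
  have h1 := (greedyState_bounds hb hq hx hx1 (k + 1)).2
  rw [← start_greedy (b := b) (q := q), start_succ_of_lt hlt,
    psum_eq_zero (hb.zero_before (k + 1))] at h1
  have h2 := psum_greedy (b := b) (q := q) x (k + 1)
  have h3 := psum_le_val hq hs (k + 1)
  have h4 := hM (k + 1) (by omega)
  linarith

end Greedy

/-- The values of the members are distinct and those of the non-zero ones fill `(0, 1)`. -/
structure IsFund (b : ℕ → ℕ → ℕ) (q : ℕ → ℝ) : Prop where
  summable : ∀ ε ∈ lang b, Summable fun k => (ε k : ℝ) * q (k + 1)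
  injOn : Set.InjOn (val q) (lang b)
  image : val q '' (lang b \ {0}) = Set.Ioo 0 1

lemma val_pos (hq : ∀ k, 0 < q k) (hs : Summable fun k => (ε k : ℝ) * q (k + 1)) (h : ε ≠ 0) :
    0 < val q ε := by
  obtain ⟨k, hk⟩ := Function.ne_iff.1 h
  refine hs.tsum_pos (fun k => mul_nonneg (Nat.cast_nonneg _) (hq _).le) k
    (mul_pos ?_ (hq _))
  exact_mod_cast Nat.pos_of_ne_zero hk

lemma isFund_of_hasSum (hb : IsProper b) (hq : ∀ k, 0 < q k) (hanti : Antitone q) (hq0 : q 0 = 1)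
    (hD : ∀ n, HasSum (fun k => (b n k : ℝ) * q (k + 1)) (q n)) : IsFund b q := by
  have hS : ∀ n m, psum q (b n) m ≤ q n := fun n m =>
    sum_le_hasSum _ (fun k _ => mul_nonneg (Nat.cast_nonneg _) (hq _).le) (hD n)
  have hbd : ∀ ε ∈ lang b, _ := fun ε hε =>
    summable_and_val_lt hb hq hS (fun _ => le_rfl) hε (m := 0) rfl
  refine ⟨fun ε hε => (hbd ε hε).1, injOn_val hb hq hS, Set.Subset.antisymm ?_ ?_⟩
  · rintro _ ⟨ε, ⟨hε, h0⟩, rfl⟩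
    refine ⟨val_pos hq (hbd ε hε).1 h0, ?_⟩
    have := (hbd ε hε).2
    simpa [psum, hq0] using this
  · rintro x ⟨hx, hx1⟩
    rw [← hq0] at hx1
    refine ⟨greedy b q x, ⟨greedy_mem_lang hb hq hD hx.le hx1, fun h => ?_⟩,
      val_greedy hb hq hanti hD hx.le hx1⟩
    have h2 := val_greedy hb hq hanti hD hx.le hx1
    rw [Set.mem_singleton_iff.1 h] at h2
    simp [val] at h2
    exact hx.ne h2

/-! ### Fundamental sequences satisfy the full recursion -/

section Converse

lemma IsFund.val_lt_one (h : IsFund b q) (hε : ε ∈ lang b) : val q ε < 1 := by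
  by_cases h0 : ε = 0
  · subst h0; simp [val]
  · have : val q ε ∈ Set.Ioo (0 : ℝ) 1 := h.image ▸ ⟨ε, ⟨hε, h0⟩, rfl⟩
    exact this.2

lemma IsFund.exists_val_eq (h : IsFund b q) (hb : IsProper b) {x : ℝ} (hx : 0 ≤ x)
    (hx1 : x < 1) : ∃ ε ∈ lang b, val q ε = x := by
  rcases hx.eq_or_lt with rfl | hx
  · exact ⟨0, zero_mem_lang hb, by simp [val]⟩
  · have : x ∈ val q '' (lang b \ {0}) := h.image ▸ ⟨hx, hx1⟩
    obtain ⟨ε, hε, hv⟩ := this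
    exact ⟨ε, hε.1, hv⟩

lemma eq_zero_of_val_lt (hq : ∀ k, 0 < q k) (hanti : Antitone q)
    (hs : Summable fun k => (ε k : ℝ) * q (k + 1)) {n : ℕ} (h : val q ε < q n) :
    ∀ k < n, ε k = 0 := by
  intro k hk
  by_contra h0
  have h1 : (1 : ℝ) ≤ ε k := by exact_mod_cast Nat.pos_of_ne_zero h0
  have h2 : (ε k : ℝ) * q (k + 1) ≤ val q ε :=
    hs.le_tsum k fun j _ => mul_nonneg (Nat.cast_nonneg _) (hq _).le
  have h3 : q n ≤ q (k + 1) := hanti hk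
  have := hq (k + 1)
  nlinarith

lemma val_single (n : ℕ) : val q (Pi.single n 1) = q (n + 1) := by
  unfold val
  rw [tsum_eq_single n fun k hk => by simp [hk]]
  simp

/-- If `Q_{n-1}` were exceeded by a partial sum of the block maximum, it would have a second
representation. -/
lemma IsFund.psum_le (h : IsFund b q) (hb : IsProper b) (hq : ∀ k, 0 < q k) (hanti : Antitone q)
    (hq0 : q 0 = 1) (n m : ℕ) : psum q (b n) m ≤ q n := by
  by_contra! hlt
  have hex : ∃ m, q n < psum q (b n) m := ⟨m, hlt⟩
  classical
  obtain ⟨i, hi⟩ : ∃ i, Nat.find hex = i + 1 := Nat.exists_eq_succ_of_ne_zero fun h0 => by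
    have := Nat.find_spec hex
    rw [h0] at this
    simp only [psum, Finset.range_zero, Finset.sum_empty] at this
    exact absurd (hq n) this.not_gt
  have h2 : q n < psum q (b n) (i + 1) := hi ▸ Nat.find_spec hex
  have h1 : psum q (b n) i ≤ q n := not_lt.1 (Nat.find_min hex (by omega))
  have hni : n ≤ i := by
    by_contra! hc
    rw [psum_eq_zero fun k hk => hb.zero_before n k (by omega)] at h2
    exact absurd (hq n) h2.not_gt
  have hqi := hq (i + 1)
  -- At `i` the maximal function overshoots `q n`; `c` is the largest digit that does not, and it
  -- leaves less than `q (i + 1)`.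
  set c := ⌊(q n - psum q (b n) i) / q (i + 1)⌋₊ with hc
  have hc1 : (c : ℝ) * q (i + 1) ≤ q n - psum q (b n) i := by
    rw [← le_div_iff₀ hqi]
    exact Nat.floor_le (div_nonneg (by linarith) hqi.le)
  have hc2 : q n - psum q (b n) i < (c + 1) * q (i + 1) := by
    rw [← div_lt_iff₀ hqi]
    exact Nat.lt_floor_add_one _
  have hcb : c < b n i := by
    rw [psum_succ] at h2
    have h3 : (c : ℝ) * q (i + 1) < b n i * q (i + 1) := by linarith
    exact_mod_cast lt_of_mul_lt_mul_right h3 hqi.le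
  obtain ⟨η, hη, hηv⟩ := h.exists_val_eq hb (x := q n - psum q (b n) i - c * q (i + 1))
    (by linarith) (by linarith [hanti (Nat.zero_le (i + 1))])
  have hη0 := eq_zero_of_val_lt hq hanti (h.summable η hη) (n := i + 1) (by linarith)
  -- Prefix of `b n`, lowered digit, then a representation `η` of the remainder: a member of value
  -- `q n`.
  set ε : ℕ → ℕ := fun k => if k < i then b n k else if k = i then c else η k with hε
  have hεn : ∀ k < n, ε k = 0 := fun k hk => by
    simp [hε, hk.trans_le hni, hb.zero_before n k hk]
  have hst : ∀ k, n ≤ k → k ≤ i → start b ε k = n := fun k hk hki =>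
    start_of_eq (start_of_zero hb hεn le_rfl) (fun j _ hj => by simp [hε, hj]) hk hki
  have hεi : ε i = c := by simp [hε]
  have hsti : start b ε (i + 1) = i + 1 := start_succ_of_lt (by rwa [hst i hni le_rfl, hεi])
  have htail : ∀ k, i + 1 ≤ k → ε k = η k := fun k hk => by
    simp [hε, show ¬ k < i by omega, show k ≠ i by omega]
  have hmem : ε ∈ lang b := by
    refine mem_lang_of_tail hη (fun k hk => ?_) htail
      (hsti.trans (start_of_zero hb hη0 le_rfl).symm)
    rcases lt_or_ge k n with hkn | hkn
    · rw [hεn k hkn]; exact Nat.zero_le _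
    · rw [hst k hkn (by omega)]
      rcases (show k ≤ i by omega).eq_or_lt with rfl | hki
      · rw [hεi]; exact hcb.le
      · simp [hε, hki]
  have hval : val q ε = q n := by
    have e1 := (h.summable ε hmem).sum_add_tsum_nat_add (i + 1)
    have e2 := (h.summable η hη).sum_add_tsum_nat_add (i + 1)
    change psum q ε (i + 1) + _ = val q ε at e1
    change psum q η (i + 1) + _ = val q η at e2
    rw [psum_eq_zero hη0] at e2
    rw [psum_succ, hεi, psum_congr (η := b n) fun k hk => by simp [hε, hk]] at e1
    have e3 : (∑' k, (ε (k + (i + 1)) : ℝ) * q (k + (i + 1) + 1)) =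
        ∑' k, (η (k + (i + 1)) : ℝ) * q (k + (i + 1) + 1) :=
      tsum_congr fun k => by rw [htail _ (by omega)]
    linarith
  -- The value 1 is not attained, and `q (n + 1)` already belongs to the unit at `n`, where `ε`
  -- vanishes.
  cases n with
  | zero => exact absurd (h.val_lt_one hmem) (by rw [hval, hq0]; exact lt_irrefl _)
  | succ n =>
    have := h.injOn hmem (single_mem_lang hb n) (by rw [hval, val_single])
    have h3 := hεn n (by omega)
    rw [this] at h3
    simp at h3

lemma IsFund.hasSum (h : IsFund b q) (hb : IsProper b) (hq : ∀ k, 0 < q k) (hanti : Antitone q)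
    (hq0 : q 0 = 1) (n : ℕ) : HasSum (fun k => (b n k : ℝ) * q (k + 1)) (q n) := by
  have hS := h.psum_le hb hq hanti hq0
  have hsum := fun n => summable_of_psum_le hq (hS n)
  suffices val q (b n) = q n by rw [← this]; exact (hsum n).1.hasSum
  refine le_antisymm (hsum n).2 (not_lt.1 fun hlt => ?_)
  have hle1 : q n ≤ 1 := hq0 ▸ hanti (Nat.zero_le n)
  obtain ⟨ε, hε, hv⟩ := h.exists_val_eq hb (x := val q (b n))
    (tsum_nonneg fun k => mul_nonneg (Nat.cast_nonneg _) (hq _).le) (by linarith)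
  have h0 := eq_zero_of_val_lt hq hanti (h.summable ε hε) (hv ▸ hlt)
  -- Here the budgets are the actual values of the maximal functions, not the weights `q n`; `ε`
  -- would be worth less than `b n`, whose value it has.
  have := (summable_and_val_lt hb hq (d := fun n => val q (b n))
    (fun n m => psum_le_val hq (hsum n).1 m) (fun n => (hsum n).2) hε
    (start_of_zero hb h0 le_rfl)).2
  rw [psum_eq_zero h0, hv] at this
  simp at this

end Converse

end BlockLang

/-! ### Sums of proper blocks and the recursive description -/

namespace Coeff

/-- The index at which the block of `ε` that contains the index `k` begins. -/
def blockStart (b : ℕ+ → Coeff) (ε : Coeff) (k : ℕ+) : ℕ+ :=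
  PNat.recOn k 1 fun k s => if ε k < b s k then k + 1 else s

/-- The coefficient functions all of whose blocks are proper, infinitely many of them. -/
def blockLang (b : ℕ+ → Coeff) : Set Coeff :=
  {ε | (∀ k, ε k ≤ b (blockStart b ε k) k) ∧ {k | ε k < b (blockStart b ε k) k}.Infinite}

variable {b : ℕ+ → Coeff} {ε η : Coeff}

lemma blockStart_one : blockStart b ε 1 = 1 := rfl

lemma blockStart_succ (k : ℕ+) : blockStart b ε (k + 1) =
    if ε k < b (blockStart b ε k) k then k + 1 else blockStart b ε k :=
  PNat.recOn_succ k _ _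

lemma blockStart_congr {m : ℕ+} (h : ∀ k < m, ε k = η k) : blockStart b ε m = blockStart b η m := by
  induction m using PNat.recOn with
  | one => rfl
  | succ m ih =>
    rw [blockStart_succ, blockStart_succ, ih fun k hk => h k (hk.trans (PNat.lt_add_right m 1)),
      h m (PNat.lt_add_right m 1)]

lemma blockStart_of_eq {n m : ℕ+} (hn : blockStart b ε n = n)
    (h : ∀ k, n ≤ k → k < m → ε k = b n k) {k : ℕ+} (hk : n ≤ k) (hkm : k ≤ m) :
    blockStart b ε k = n := by
  induction k using PNat.recOn with
  | one => rw [le_antisymm hk one_le] at hn ⊢; exact hn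
  | succ k ih =>
    rcases hk.eq_or_lt with rfl | hk
    · exact hn
    have hk' : n ≤ k := PNat.lt_add_one_iff.1 hk
    have hkm' : k < m := (PNat.lt_add_right k 1).trans_le hkm
    have ih := ih hk' hkm'.le
    rw [blockStart_succ, ih, h k hk' hkm', if_neg (lt_irrefl _)]

lemma exists_mem_block {n i : ℕ+ → ℕ+} (h1 : n 1 = 1) (hs : ∀ m, n (m + 1) = i m + 1)
    (hle : ∀ m, n m ≤ i m) (k : ℕ+) : ∃ m, n m ≤ k ∧ k ≤ i m := by
  induction k using PNat.recOn with
  | one => exact ⟨1, h1.le, one_le⟩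
  | succ k ih =>
    obtain ⟨m, hm, hk⟩ := ih
    rcases hk.eq_or_lt with rfl | hk
    · exact ⟨m + 1, (hs m).le, (hs m).symm.le.trans (hle _)⟩
    · exact ⟨m, hm.trans (PNat.lt_add_right k 1).le, PNat.add_one_le_iff.2 hk⟩

lemma block_strictMono {n i : ℕ+ → ℕ+} (hs : ∀ m, n (m + 1) = i m + 1)
    (hle : ∀ m, n m ≤ i m) : StrictMono n := by
  intro m m' h
  induction m' using PNat.recOn with
  | one => exact absurd h (not_lt_one)
  | succ m' ih =>
    have h2 : n m' < n (m' + 1) := (hs m').symm ▸ PNat.lt_add_one_iff.2 (hle m')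
    rcases (PNat.lt_add_one_iff.1 h).eq_or_lt with rfl | h
    · exact h2
    · exact (ih h).trans h2

lemma block_unique {n i : ℕ+ → ℕ+} (hs : ∀ m, n (m + 1) = i m + 1) (hle : ∀ m, n m ≤ i m)
    {m m' k : ℕ+} (h1 : n m ≤ k) (h2 : k ≤ i m) (h1' : n m' ≤ k) (h2' : k ≤ i m') : m = m' := by
  have key : ∀ {m m'}, n m' ≤ k → k ≤ i m → m' ≤ m := fun {m m'} ha hb => by
    by_contra! hlt
    have := (block_strictMono hs hle).monotone (PNat.add_one_le_iff.2 hlt)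
    rw [hs] at this
    exact absurd (PNat.add_one_le_iff.1 (this.trans ha)) hb.not_gt
  exact le_antisymm (key h1 h2') (key h1' h2)

/-- The supports tile the indices, so each digit comes from one summand, and induction over the
blocks identifies `blockStart` with their left ends. -/
lemma determinedBy_subset_blockLang : determinedBy b ⊆ blockLang b := by
  rintro ε ⟨ζ, n, i, h1, hs, hblock, hε⟩
  have hle := fun m => (hblock m).le
  have hval : ∀ m k, n m ≤ k → k ≤ i m → ε k = ζ m k := by
    intro m k hk hk'
    rw [hε, finsum_eq_single _ m]
    intro m' hne
    apply (hblock m').eq_zero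
    by_contra! hc
    exact hne (block_unique hs hle hc.1 hc.2 hk hk')
  have hstart : ∀ m, blockStart b ε (n m) = n m →
      ∀ k, n m ≤ k → k ≤ i m → blockStart b ε k = n m := fun m hm k hk hk' =>
    blockStart_of_eq hm (fun j hj hj' => by
      rw [hval m j hj hj'.le, (hblock m).eq_before j hj hj']) hk hk'
  have hlt : ∀ m, ε (i m) < b (n m) (i m) := fun m => by
    rw [hval m _ (hle m) le_rfl]; exact (hblock m).last_lt
  have hn : ∀ m, blockStart b ε (n m) = n m := by
    intro m
    induction m using PNat.recOn with
    | one => rw [h1]; rfl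
    | succ m ih =>
      rw [hs, blockStart_succ, if_pos]
      rw [hstart m ih _ (hle m) le_rfl]
      exact hlt m
  have hst := fun m => hstart m (hn m)
  refine ⟨fun k => ?_, ?_⟩
  · obtain ⟨m, hk, hk'⟩ := exists_mem_block h1 hs hle k
    rw [hst m k hk hk']
    rcases hk'.eq_or_lt with rfl | hk'
    · exact (hlt m).le
    · rw [hval m k hk hk'.le, (hblock m).eq_before k hk hk']
  · refine Set.infinite_of_forall_exists_gt fun k => ?_
    obtain ⟨m, hk, hk'⟩ := exists_mem_block h1 hs hle (k + 1)
    refine ⟨i m, ?_, PNat.add_one_le_iff.1 hk'⟩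
    rw [Set.mem_ofPred_eq, hst m _ (hle m) le_rfl]
    exact hlt m

/-- Cut after each digit below its cap; since there are infinitely many, every block ends. -/
lemma blockLang_subset_determinedBy : blockLang b ⊆ determinedBy b := by
  rintro ε ⟨hle, hinf⟩
  have hnext : ∀ k : ℕ+, ∃ i, k ≤ i ∧ ε i < b (blockStart b ε i) i ∧
      ∀ j, k ≤ j → j < i → ¬ ε j < b (blockStart b ε j) j := by
    intro k
    have hex : ∃ i, k ≤ i ∧ ε i < b (blockStart b ε i) i := by
      obtain ⟨i, hi, hk⟩ := hinf.exists_gt k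
      exact ⟨i, hk.le, hi⟩
    classical
    exact ⟨PNat.find hex, (PNat.find_spec hex).1, (PNat.find_spec hex).2,
      fun j hj hlt h => PNat.find_min hex hlt ⟨hj, h⟩⟩
  choose next hn1 hn2 hn3 using hnext
  set n : ℕ+ → ℕ+ := fun m => PNat.recOn m 1 fun _ s => next s + 1 with hn
  have hs : ∀ m, n (m + 1) = next (n m) + 1 := fun m => PNat.recOn_succ m _ _
  have hst : ∀ m, blockStart b ε (n m) = n m := by
    intro m
    induction m using PNat.recOn with
    | one => rfl
    | succ m ih => rw [hs, blockStart_succ, if_pos (hn2 _)]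
  have hst' : ∀ m k, n m ≤ k → k ≤ next (n m) → blockStart b ε k = n m := by
    intro m k hk hk'
    induction k using PNat.recOn with
    | one => exact (le_antisymm hk one_le).symm
    | succ k ih =>
      rcases hk.eq_or_lt with h | hk
      · rw [← h]; exact hst m
      have hk2 : n m ≤ k := PNat.lt_add_one_iff.1 hk
      have hk3 : k < next (n m) := PNat.add_one_le_iff.1 hk'
      rw [blockStart_succ, if_neg (hn3 _ _ hk2 hk3), ih hk2 hk3.le]
  set ζ : ℕ+ → Coeff := fun m k => if n m ≤ k ∧ k ≤ next (n m) then ε k else 0 with hζ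
  have hζ1 : ∀ m k, n m ≤ k → k ≤ next (n m) → ζ m k = ε k := fun m k h h' => if_pos ⟨h, h'⟩
  refine ⟨ζ, n, fun m => next (n m), rfl, hs, fun m => ⟨hn1 _, ?_, ?_, ?_⟩, fun k => ?_⟩
  · have := hn2 (n m)
    rw [hst' m _ (hn1 _) le_rfl] at this
    rwa [hζ1 m _ (hn1 _) le_rfl]
  · intro k hk hk'
    have h1 := hle k
    have h2 := hn3 _ k hk hk'
    rw [hst' m k hk hk'.le] at h1 h2
    rw [hζ1 m k hk hk'.le]
    exact le_antisymm h1 (not_lt.1 h2)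
  · intro k hk
    refine if_neg fun h => ?_
    rcases hk with hk | hk
    · exact absurd h.1 hk.not_ge
    · exact absurd h.2 hk.not_ge
  · have hnle := fun m => hn1 (n m)
    obtain ⟨m, hk, hk'⟩ := exists_mem_block (n := n) (i := fun m => next (n m)) rfl hs hnle k
    rw [finsum_eq_single _ m, hζ1 m k hk hk']
    intro m' hne
    exact if_neg fun h => hne (block_unique (n := n) (i := fun m => next (n m)) hs hnle h.1 h.2 hk hk')

lemma determinedBy_eq_blockLang : determinedBy b = blockLang b :=
  determinedBy_subset_blockLang.antisymm blockLang_subset_determinedBy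

/-! ### Transfer between indices from 1 and indices from 0 -/

section Reindex

/-- The family of block maxima, indexed from `0`. -/
def shiftFamily (b : ℕ+ → Coeff) (n k : ℕ) : ℕ := b n.succPNat k.succPNat

/-- Reindexing of coefficient functions from `0`. -/
def shift : Coeff ≃ (ℕ → ℕ) := Equiv.arrowCongr Equiv.pnatEquivNat (Equiv.refl ℕ)

lemma shift_apply (k : ℕ) : shift ε k = ε k.succPNat := rfl

lemma shift_eq_zero_iff : shift ε = 0 ↔ ε = 0 := by
  have : shift (0 : Coeff) = 0 := rfl
  rw [← this, shift.injective.eq_iff]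

lemma start_shift (k : ℕ) : (BlockLang.start (shiftFamily b) (shift ε) k).succPNat =
    blockStart b ε k.succPNat := by
  induction k with
  | zero => rfl
  | succ k ih =>
    have : (k + 1).succPNat = k.succPNat + 1 := rfl
    rw [this, blockStart_succ]
    simp only [BlockLang.start]
    rw [apply_ite Nat.succPNat, ← ih]
    rfl

lemma shift_mem_lang_iff : shift ε ∈ BlockLang.lang (shiftFamily b) ↔ ε ∈ blockLang b := by
  refine and_congr ⟨fun h k => ?_, fun h k => ?_⟩ ⟨fun h => ?_, fun h m => ?_⟩
  · have := h k.natPred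
    simpa only [shiftFamily, start_shift, shift_apply, PNat.succPNat_natPred] using this
  · simpa only [shiftFamily, start_shift, shift_apply] using h k.succPNat
  · refine Set.infinite_of_forall_exists_gt fun m => ?_
    obtain ⟨k, hk, hlt⟩ := h m
    refine ⟨k.succPNat, by
      simpa only [shiftFamily, start_shift, shift_apply, Set.mem_ofPred_eq] using hlt, ?_⟩
    rw [← PNat.coe_lt_coe]
    simpa [Nat.succPNat_coe] using Nat.lt_succ_of_le hk
  · obtain ⟨k, hk, hlt⟩ := h.exists_gt m.succPNat
    refine ⟨k.natPred, ?_, ?_⟩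
    · rw [← PNat.coe_lt_coe, Nat.succPNat_coe, ← PNat.natPred_add_one k] at hlt
      omega
    · simpa only [shiftFamily, start_shift, shift_apply, PNat.succPNat_natPred, Set.mem_ofPred_eq] using hk

variable {Q : ℕ+ → ℝ}

lemma withOne_zero : withOne Q 0 = 1 := by simp [withOne]

lemma withOne_succ (k : ℕ) : withOne Q (k + 1) = Q k.succPNat := by
  simp only [withOne, Nat.succ_pos, dif_pos]; rfl

lemma withOne_pos (hQ : ∀ k, 0 < Q k) (k : ℕ) : 0 < withOne Q k := by
  cases k with
  | zero => rw [withOne_zero]; exact one_pos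
  | succ k => rw [withOne_succ]; exact hQ _

lemma withOne_strictAnti (hQ : StrictAnti Q) (h1 : ∀ k, Q k < 1) : StrictAnti (withOne Q) := by
  refine strictAnti_nat_of_succ_lt fun k => ?_
  cases k with
  | zero => rw [withOne_zero, withOne_succ]; exact h1 _
  | succ k => rw [withOne_succ, withOne_succ]; exact hQ (Nat.succPNat_lt_succPNat.2 k.lt_succ_self)

lemma hasSum_shift_iff {a : ℝ} : HasSum (fun k => (shift ε k : ℝ) * withOne Q (k + 1)) a ↔
    HasSum (fun k : ℕ+ => (ε k : ℝ) * Q k) a := by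
  rw [← Equiv.pnatEquivNat.symm.hasSum_iff]
  simp only [withOne_succ]
  rfl

lemma summable_shift_iff : (Summable fun k => (shift ε k : ℝ) * withOne Q (k + 1)) ↔
    Summable fun k : ℕ+ => (ε k : ℝ) * Q k :=
  exists_congr fun _ => hasSum_shift_iff

lemma val_shift : BlockLang.val (withOne Q) (shift ε) = value Q ε := by
  rw [BlockLang.val, value, ← Equiv.pnatEquivNat.symm.tsum_eq]
  simp only [withOne_succ]
  rfl

lemma fullRecursion_iff : FullRecursion b Q ↔ ∀ n, HasSum
    (fun k => (shiftFamily b n k : ℝ) * withOne Q (k + 1)) (withOne Q n) := by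
  refine ⟨fun h n => hasSum_shift_iff.2 (h n.succPNat), fun h n => ?_⟩
  have := h n.natPred
  have e : shiftFamily b n.natPred = shift (b n) := by
    ext k; simp [shiftFamily, shift_apply]
  simp only [e] at this
  exact hasSum_shift_iff.1 this

lemma isProper_shiftFamily (hb : ∀ n, HasOrder (b n) n ∧ InfSupport (b n)) :
    BlockLang.IsProper (shiftFamily b) := by
  refine ⟨fun n k hk => ?_, fun n => Nat.pos_of_ne_zero (hb _).1.1, fun n m => ?_⟩
  · by_contra h
    have : n.succPNat ≤ k.succPNat := (hb n.succPNat).1.2 h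
    exact absurd (Nat.succPNat_le_succPNat.1 this) (by omega)
  · obtain ⟨k, hk, hlt⟩ := (hb n.succPNat).2.exists_gt m.succPNat
    refine ⟨k.natPred, ?_, Nat.pos_of_ne_zero ?_⟩
    · rw [← PNat.coe_lt_coe, Nat.succPNat_coe, ← PNat.natPred_add_one k] at hlt
      omega
    · simpa only [shiftFamily, PNat.succPNat_natPred, Set.mem_ofPred_eq] using hk

lemma isFundamental_blockLang_iff (hQ : ∀ k, Q k ∈ Set.Ioo (0 : ℝ) 1) :
    IsFundamental (blockLang b) (Set.Ioo 0 1) Q ↔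
      BlockLang.IsFund (shiftFamily b) (withOne Q) := by
  have himg : BlockLang.val (withOne Q) '' (BlockLang.lang (shiftFamily b) \ {0}) =
      valueSet (blockLang b) Q := by
    ext x
    constructor
    · rintro ⟨f, ⟨hf, h0⟩, rfl⟩
      obtain ⟨ε, rfl⟩ := shift.surjective f
      exact ⟨ε, ⟨shift_mem_lang_iff.1 hf, fun h => h0 (shift_eq_zero_iff.2 h)⟩, val_shift.symm⟩
    · rintro ⟨ε, ⟨hε, h0⟩, rfl⟩
      exact ⟨shift ε, ⟨shift_mem_lang_iff.2 hε, fun h => h0 (shift_eq_zero_iff.1 h)⟩, val_shift⟩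
  constructor
  · rintro ⟨-, ⟨hs, hinj⟩, hv⟩
    refine ⟨fun f hf => ?_, fun f hf g hg hfg => ?_, himg.trans hv⟩
    · obtain ⟨ε, rfl⟩ := shift.surjective f
      exact summable_shift_iff.2 (hs ε (shift_mem_lang_iff.1 hf))
    · obtain ⟨ε, rfl⟩ := shift.surjective f
      obtain ⟨η, rfl⟩ := shift.surjective g
      rw [val_shift, val_shift] at hfg
      rw [hinj (shift_mem_lang_iff.1 hf) (shift_mem_lang_iff.1 hg) hfg]
  · rintro ⟨hs, hinj, hv⟩
    refine ⟨hQ, ⟨fun ε hε => summable_shift_iff.1 (hs _ (shift_mem_lang_iff.2 hε)),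
      fun ε hε η hη h => ?_⟩, himg.symm.trans hv⟩
    rw [← val_shift, ← val_shift] at h
    exact shift.injective (hinj (shift_mem_lang_iff.2 hε) (shift_mem_lang_iff.2 hη) h)

/-- A decreasing sequence is fundamental under the collection determined by `b` if and only if it
satisfies the full recursion. -/
theorem isFundamental_determinedBy_iff (hb : ∀ n, HasOrder (b n) n ∧ InfSupport (b n))
    (hanti : StrictAnti Q) (hQ : ∀ k, Q k ∈ Set.Ioo (0 : ℝ) 1) :
    IsFundamental (determinedBy b) (Set.Ioo 0 1) Q ↔ FullRecursion b Q := by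
  have hp := isProper_shiftFamily hb
  have hpos := withOne_pos fun k => (hQ k).1
  have hanti' := (withOne_strictAnti hanti fun k => (hQ k).2).antitone
  rw [determinedBy_eq_blockLang, isFundamental_blockLang_iff hQ, fullRecursion_iff]
  exact ⟨fun h => h.hasSum hp hpos hanti' withOne_zero,
    BlockLang.isFund_of_hasSum hp hpos hanti' withOne_zero⟩

end Reindex

end Coeff

namespace Coeff

/-! ### Zeckendorf collections are determined by their maximal functions -/

section Zeckendorf

variable {E : Set Coeff} {b : ℕ+ → Coeff} {M : ℕ+}

lemma lex_lt_iff {x y : Coeff} :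
    toLex x < toLex y ↔ ∃ i, (∀ j < i, x j = y j) ∧ x i < y i := Iff.rfl

/-- As `z` shares the prefix of `x`, a first difference between `x` and `y` before `M` would put `y`
above `z` too. -/
lemma eq_of_lex_between {x y z : Coeff} (hxy : toLex x < toLex y) (hyz : toLex y ≤ toLex z)
    (h : ∀ k < M, x k = z k) : ∀ k < M, x k = y k := by
  obtain ⟨i, hi, hlt⟩ := lex_lt_iff.1 hxy
  rcases lt_or_ge i M with hiM | hiM
  · refine absurd hyz (not_le.2 (lex_lt_iff.2 ⟨i, fun j hj => ?_, ?_⟩))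
    · rw [← h j (hj.trans hiM), hi j hj]
    · rwa [← h i hiM]
  · exact fun k hk => hi k (hk.trans_le hiM)

lemma res_apply_of_le {ε : Coeff} {k : ℕ+} (h : k ≤ M) : res M ε k = ε k := if_pos h

lemma res_apply_of_lt {ε : Coeff} {k : ℕ+} (h : M < k) : res M ε k = 0 := if_neg h.not_ge

lemma trunc_apply_of_lt {x : Coeff} (hx : x ∈ trunc E M) {k : ℕ+} (h : M < k) : x k = 0 := by
  obtain ⟨η, -, rfl⟩ := hx
  exact res_apply_of_lt h

lemma res_eq_of_agree {x ε : Coeff} (hx : x ∈ trunc E M) (h : ∀ k ≤ M, ε k = x k) :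
    res M ε = x := by
  ext k
  rcases le_or_gt k M with hk | hk
  · rw [res_apply_of_le hk, h k hk]
  · rw [res_apply_of_lt hk, trunc_apply_of_lt hx hk]

lemma res_mem_trunc_of_le {ε : Coeff} {j : ℕ+} (hj : j ≤ M) (h : res M ε ∈ trunc E M) :
    res j ε ∈ trunc E j := by
  obtain ⟨η, hη, he⟩ := h
  refine ⟨η, hη, funext fun k => ?_⟩
  rcases le_or_gt k j with hk | hk
  · have := congrFun he k
    rw [res_apply_of_le (hk.trans hj), res_apply_of_le (hk.trans hj)] at this
    rw [res_apply_of_le hk, res_apply_of_le hk, this]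
  · rw [res_apply_of_lt hk, res_apply_of_lt hk]

lemma basis_self (n : ℕ+) : basis n n = 1 := if_pos rfl

lemma basis_of_ne {n k : ℕ+} (h : k ≠ n) : basis n k = 0 := if_neg h

lemma IsZeckendorf.trunc_finite (hE : IsZeckendorf E) (hb : IsMaximal E 1 (b 1)) (M : ℕ+) :
    (trunc E M).Finite := by
  obtain ⟨hmem, hmax⟩ := hb.first rfl M
  refine ((hE.finite_below M _ hmem).union (Set.finite_singleton (res M (b 1)))).subset ?_
  intro x hx
  rcases (hmax x hx).eq_or_lt with h | h
  · exact Or.inr h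
  · exact Or.inl ⟨hx, h⟩

lemma exists_isImmSucc {X : Set Coeff} (hX : X.Finite) {x z : Coeff} (hz : z ∈ X)
    (h : toLex x < toLex z) : ∃ ν, IsImmSucc X x ν ∧ toLex ν ≤ toLex z := by
  obtain ⟨ν, ⟨hν, hlt⟩, hmin⟩ := Set.exists_min_image {y ∈ X | toLex x < toLex y} toLex
    (hX.subset fun y hy => hy.1) ⟨z, hz, h⟩
  exact ⟨ν, ⟨hν, hlt, fun y hy hy' => hmin y ⟨hy, hy'⟩⟩, hmin z ⟨hz, h⟩⟩

lemma exists_isImmSucc_of_lt {X : Set Coeff} (hX : X.Finite) {x z : Coeff} (hx : x ∈ X)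
    (hz : z ∈ X) (h : toLex z < toLex x) : ∃ p ∈ X, IsImmSucc X p x := by
  obtain ⟨p, ⟨hp, hlt⟩, hmax⟩ := Set.exists_max_image {y ∈ X | toLex y < toLex x} toLex
    (hX.subset fun y hy => hy.1) ⟨z, hz, h⟩
  exact ⟨p, hp, hx, hlt, fun y hy hy' =>
    not_lt.1 fun hc => absurd (hmax y ⟨hy, hc⟩) hy'.not_ge⟩

/-- Members that agree before `M` fill an interval at `M`. -/
lemma IsZeckendorf.add_basis_mem (hE : IsZeckendorf E) (hb : ∀ n, IsMaximal E n (b n))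
    {x z : Coeff} (hx : x ∈ trunc E M) (hz : z ∈ trunc E M) (h : ∀ k < M, x k = z k)
    (hM : x M < z M) : x + basis M ∈ trunc E M := by
  have hxz : toLex x < toLex z := lex_lt_iff.2 ⟨M, h, hM⟩
  obtain ⟨ν, hν, hνz⟩ := exists_isImmSucc (hE.trunc_finite (hb 1) M) hz hxz
  have hagree := eq_of_lex_between hν.2.1 hνz h
  by_contra hne
  -- A carry would raise a digit at some `n < M`, but the successor keeps the common prefix.
  obtain ⟨n, hn, -, hνeq⟩ := hE.succ_form b hb M x hx
    (hxz.trans_le (((hb 1).first rfl M).2 z hz)) ν hν (fun e => hne (e ▸ hν.1))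
  have := hagree n hn
  rw [hνeq, Pi.add_apply, res_apply_of_le le_rfl, basis_self] at this
  omega

/-- Each prefix of a member can be followed by `0`. -/
lemma IsZeckendorf.exists_zero_digit (hE : IsZeckendorf E) (hb : ∀ n, IsMaximal E n (b n))
    {ρ : Coeff} (hρ : ρ ∈ trunc E M) :
    ∃ x ∈ trunc E M, (∀ k < M, x k = ρ k) ∧ x M = 0 := by
  have hfin := hE.trunc_finite (hb 1) M
  obtain ⟨x, ⟨hx, hxρ⟩, hmin⟩ := Set.exists_min_image
    {y ∈ trunc E M | ∀ k < M, y k = ρ k} toLex (hfin.subset fun y hy => hy.1)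
    ⟨ρ, hρ, fun _ _ => rfl⟩
  refine ⟨x, hx, hxρ, ?_⟩
  have h0 : (0 : Coeff) ∈ trunc E M := ⟨0, hE.zero_mem, by ext k; simp [res]⟩
  by_contra hxM
  have hlt : toLex (0 : Coeff) < toLex x := by
    rcases lt_trichotomy (toLex (0 : Coeff)) (toLex x) with h | h | h
    · exact h
    · exact absurd (congrFun (toLex.injective h).symm M) hxM
    · obtain ⟨i, -, hi⟩ := lex_lt_iff.1 h
      exact absurd hi (Nat.not_lt_zero _)
  obtain ⟨p, hp, hsucc⟩ := exists_isImmSucc_of_lt hfin hx h0 hlt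
  -- If `x` arises by adding `basis M`, its predecessor has the same prefix, against minimality; if
  -- it arises by a carry, its digit at `M` is 0.
  obtain ⟨n, hn, -, hxeq⟩ := hE.succ_form b hb M p hp
    (hsucc.2.1.trans_le (((hb 1).first rfl M).2 x hx)) x hsucc (fun e => by
      refine absurd (hmin p ⟨hp, fun k hk => ?_⟩) hsucc.2.1.not_ge
      rw [← hxρ k hk, e, Pi.add_apply, basis_of_ne hk.ne, add_zero])
  rw [hxeq, Pi.add_apply, res_apply_of_lt hn, basis_of_ne hn.ne'] at hxM
  exact hxM rfl

/-- The largest digit that may follow a prefix of a member is that of the current block maximum. -/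
lemma IsZeckendorf.exists_max_digit (hE : IsZeckendorf E) (hb : ∀ n, IsMaximal E n (b n))
    (ih : ∀ j < M, ∀ ε, res j ε ∈ trunc E j → ε j ≤ b (blockStart b ε j) j)
    {ρ : Coeff} (hρ : ρ ∈ trunc E M) :
    ∃ x ∈ trunc E M, (∀ k < M, x k = ρ k) ∧ x M = b (blockStart b ρ M) M ∧ ρ M ≤ x M := by
  have hfin := hE.trunc_finite (hb 1) M
  obtain ⟨x, ⟨hx, hxρ⟩, hmax⟩ := Set.exists_max_image
    {y ∈ trunc E M | ∀ k < M, y k = ρ k} toLex (hfin.subset fun y hy => hy.1)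
    ⟨ρ, hρ, fun _ _ => rfl⟩
  refine ⟨x, hx, hxρ, ?_, ?_⟩
  · rw [← blockStart_congr hxρ]
    rcases ((hb 1).first rfl M).2 x hx |>.eq_or_lt with h | h
    · have hx1 : x = res M (b 1) := toLex.injective h
      have hk : ∀ k ≤ M, x k = b 1 k := fun k hk => by rw [hx1, res_apply_of_le hk]
      rw [blockStart_of_eq blockStart_one (fun k _ hkM => hk k hkM.le) one_le le_rfl,
        hk M le_rfl]
    · obtain ⟨ν, hν, -⟩ := exists_isImmSucc hfin ((hb 1).first rfl M).1 h
      obtain ⟨n, hn, hbn, hνeq⟩ := hE.succ_form b hb M x hx h ν hν (fun e => by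
        refine absurd (hmax ν ⟨hν.1, fun k hk => ?_⟩) hν.2.1.not_ge
        rw [e, Pi.add_apply, basis_of_ne hk.ne, add_zero, hxρ k hk])
      have hνk : ∀ k < n, ν k = x k := fun k hk => by
        rw [hνeq, Pi.add_apply, res_apply_of_le hk.le, basis_of_ne hk.ne, add_zero]
      -- The carry gives `ν` the digit `x n + 1` at `n`. The induction hypothesis for `ν` puts `x n`
      -- below its cap, so a block of `x` opens at `n + 1`.
      have h1 := ih n hn ν (res_mem_trunc_of_le hn.le (by
        rw [res_eq_of_agree hν.1 fun _ _ => rfl]; exact hν.1))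
      rw [blockStart_congr hνk, hνeq, Pi.add_apply, res_apply_of_le le_rfl, basis_self] at h1
      have h2 : blockStart b x (n + 1) = n + 1 := by
        rw [blockStart_succ, if_pos (Nat.lt_of_succ_le h1)]
      rw [blockStart_of_eq h2 (fun k hk hkM => (hbn k (PNat.add_one_le_iff.1 hk) hkM.le).symm)
        (PNat.add_one_le_iff.2 hn) le_rfl, hbn M hn le_rfl]
  · by_contra! hlt
    exact absurd (hmax ρ ⟨hρ, fun _ _ => rfl⟩) (not_le.2 (lex_lt_iff.2 ⟨M, hxρ, hlt⟩))

/-- By induction each admissible prefix occurs; after it both 0 and the cap may follow, and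
`add_basis_mem` fills the digits between. -/
lemma IsZeckendorf.res_mem_trunc_iff (hE : IsZeckendorf E) (hb : ∀ n, IsMaximal E n (b n))
    (M : ℕ+) : ∀ ε, res M ε ∈ trunc E M ↔ ∀ k ≤ M, ε k ≤ b (blockStart b ε k) k := by
  induction M using PNat.strongInductionOn with
  | _ M ih =>
  have ih' : ∀ j < M, ∀ ε, res j ε ∈ trunc E j → ε j ≤ b (blockStart b ε j) j :=
    fun j hj ε h => (ih j hj ε).1 h j le_rfl
  refine fun ε => ⟨fun h k hk => ?_, fun h => ?_⟩
  · rcases hk.eq_or_lt with rfl | hk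
    · obtain ⟨x, -, hx, hmax, hle⟩ := hE.exists_max_digit hb ih' h
      rw [hmax, res_apply_of_le le_rfl,
        blockStart_congr fun j hj => res_apply_of_le hj.le] at hle
      exact hle
    · exact ih' k hk ε (res_mem_trunc_of_le hk.le h)
  · obtain ⟨ρ, hρ, hρε⟩ : ∃ ρ ∈ trunc E M, ∀ k < M, ρ k = ε k := by
      rcases eq_or_ne M 1 with rfl | hM
      · exact ⟨res 1 0, ⟨0, hE.zero_mem, rfl⟩, fun k hk => absurd hk not_lt_one⟩
      · obtain ⟨j, rfl⟩ := PNat.exists_eq_succ_of_ne_one hM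
        have hj := PNat.lt_add_right j 1
        obtain ⟨η, hη, he⟩ := (ih j hj ε).2 fun k hk => h k (hk.trans hj.le)
        refine ⟨res (j + 1) η, ⟨η, hη, rfl⟩, fun k hk => ?_⟩
        have := congrFun he k
        rwa [res_apply_of_le (PNat.lt_add_one_iff.1 hk),
          res_apply_of_le (PNat.lt_add_one_iff.1 hk), ← res_apply_of_le hk.le (ε := η)] at this
    obtain ⟨z, hz, hzρ, hmax, -⟩ := hE.exists_max_digit hb ih' hρ
    have hdigit : ∀ c ≤ z M, ∃ x ∈ trunc E M, (∀ k < M, x k = ρ k) ∧ x M = c := by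
      intro c
      induction c with
      | zero => exact fun _ => hE.exists_zero_digit hb hρ
      | succ c ihc =>
        intro hc
        obtain ⟨x, hx, hxρ, hxM⟩ := ihc (by omega)
        refine ⟨x + basis M, hE.add_basis_mem hb hx hz (fun k hk => by rw [hxρ k hk, hzρ k hk])
          (by omega), fun k hk => ?_, ?_⟩
        · rw [Pi.add_apply, basis_of_ne hk.ne, add_zero, hxρ k hk]
        · rw [Pi.add_apply, basis_self, hxM]
    obtain ⟨x, hx, hxρ, hxM⟩ := hdigit (ε M) (by
      rw [hmax, blockStart_congr hρε]; exact h M le_rfl)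
    rw [res_eq_of_agree hx fun k hk => ?_]
    · exact hx
    · rcases hk.eq_or_lt with rfl | hk
      · exact hxM.symm
      · rw [hxρ k hk, hρε k hk]

/-- Raising the last digit by one is admissible exactly below the cap, and nothing then lies
between. The membership axiom thus asks for admissible digits and infinitely many closed blocks. -/
lemma IsZeckendorf.isImmSucc_iff (hE : IsZeckendorf E) (hb : ∀ n, IsMaximal E n (b n))
    (M : ℕ+) (ε : Coeff) :
    (res M ε ∈ trunc E M ∧ IsImmSucc (trunc E M) (res M ε) (res M (ε + basis M))) ↔
      (∀ k ≤ M, ε k ≤ b (blockStart b ε k) k) ∧ ε M < b (blockStart b ε M) M := by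
  have hbefore : ∀ k < M, (ε + basis M) k = ε k := fun k hk => by
    rw [Pi.add_apply, basis_of_ne hk.ne, add_zero]
  have hat : (ε + basis M) M = ε M + 1 := by rw [Pi.add_apply, basis_self]
  rw [hE.res_mem_trunc_iff hb]
  refine and_congr_right fun hadm => ⟨fun h => ?_, fun h => ⟨?_, ?_, fun x hx hlt => ?_⟩⟩
  · have := (hE.res_mem_trunc_iff hb M _).1 h.1 M le_rfl
    rwa [blockStart_congr hbefore, hat] at this
  · rw [hE.res_mem_trunc_iff hb]
    intro k hk
    rcases hk.eq_or_lt with rfl | hk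
    · rwa [blockStart_congr hbefore, hat]
    · rw [blockStart_congr fun j hj => hbefore j (hj.trans hk), hbefore k hk]
      exact hadm k hk.le
  · refine lex_lt_iff.2 ⟨M, fun j hj => ?_, ?_⟩
    · rw [res_apply_of_le hj.le, res_apply_of_le hj.le, hbefore j hj]
    · rw [res_apply_of_le le_rfl, res_apply_of_le le_rfl, hat]
      exact Nat.lt_succ_self _
  · obtain ⟨i, hi, hxi⟩ := lex_lt_iff.1 hlt
    have hiM : i ≤ M := by
      by_contra! hc
      rw [trunc_apply_of_lt hx hc] at hxi
      exact absurd hxi (Nat.not_lt_zero _)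
    rw [res_apply_of_le hiM] at hxi
    have hbx : ∀ j < i, res M (ε + basis M) j = x j := fun j hj => by
      have hjM := hj.trans_le hiM
      rw [res_apply_of_le hjM.le, hbefore j hjM, ← hi j hj, res_apply_of_le hjM.le]
    rcases hiM.eq_or_lt with rfl | hiM
    · rcases (Nat.succ_le_of_lt hxi).eq_or_lt with he | hl
      · rw [res_eq_of_agree hx fun k hk => ?_]
        rcases hk.eq_or_lt with rfl | hk
        · rw [hat]; exact he
        · rw [← hbx k hk, res_apply_of_le hk.le]
      · refine (lex_lt_iff.2 ⟨i, hbx, ?_⟩).le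
        rw [res_apply_of_le le_rfl, hat]
        exact hl
    · refine (lex_lt_iff.2 ⟨i, hbx, ?_⟩).le
      rwa [res_apply_of_le hiM.le, hbefore i hiM]

/-- A Zeckendorf collection is determined by its maximal coefficient functions. -/
theorem IsZeckendorf.eq_determinedBy (hE : IsZeckendorf E) (hb : ∀ n, IsMaximal E n (b n)) :
    E = determinedBy b := by
  rw [determinedBy_eq_blockLang]
  ext ε
  rw [hE.mem_iff ε]
  simp only [hE.isImmSucc_iff hb]
  constructor
  · refine fun h => ⟨fun k => ?_, h.mono fun M hM => hM.2⟩
    obtain ⟨M, hM, hk⟩ := h.exists_gt k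
    exact hM.1 k hk.le
  · exact fun h => h.2.mono fun M hM => ⟨fun k _ => h.1 k, hM⟩

end Zeckendorf

end Coeff

namespace BlockLang

variable {b : ℕ → ℕ → ℕ} {q : ℕ → ℝ}

/-! ### Non-terminating expansions for part (1a) -/

section CeilExpansion

/-- The remainder before the index `k` of the expansion of `q n` in which each digit from the
index `n` on is the largest one that leaves a positive remainder. -/
noncomputable def ceilRem (q : ℕ → ℝ) (n : ℕ) : ℕ → ℝ
  | 0 => q n
  | k + 1 => ceilRem q n k -
      ((if k < n then 0 else ⌈ceilRem q n k / q (k + 1)⌉₊ - 1 : ℕ) : ℝ) * q (k + 1)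

/-- The digits of the expansion of `q n` with positive remainders. -/
noncomputable def ceilDigit (q : ℕ → ℝ) (n k : ℕ) : ℕ :=
  if k < n then 0 else ⌈ceilRem q n k / q (k + 1)⌉₊ - 1

lemma ceilRem_succ (n k : ℕ) :
    ceilRem q n (k + 1) = ceilRem q n k - ceilDigit q n k * q (k + 1) := rfl

lemma ceilRem_of_le {n k : ℕ} (h : k ≤ n) : ceilRem q n k = q n := by
  induction k with
  | zero => rfl
  | succ k ih => rw [ceilRem_succ, ih (by omega), ceilDigit, if_pos (by omega)]; simp

lemma psum_ceilDigit (n m : ℕ) : psum q (ceilDigit q n) m = q n - ceilRem q n m := by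
  induction m with
  | zero => simp [psum, ceilRem]
  | succ m ih => rw [psum_succ, ih, ceilRem_succ]; ring

/-- With `t` the quotient of the remainder by `q (k + 1)`, the bounds `⌈t⌉ - 1 < t ≤ ⌈t⌉` place the
next remainder in `(0, q (k + 1)]`. -/
lemma ceilRem_bounds (hq : ∀ k, 0 < q k) (n k : ℕ) :
    0 < ceilRem q n k ∧ (n ≤ k → ceilRem q n k ≤ q k) := by
  induction k with
  | zero => exact ⟨hq n, fun h => by simp [ceilRem, Nat.le_zero.1 h]⟩
  | succ k ih =>
    rcases lt_or_ge k n with hk | hk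
    · rw [ceilRem_of_le hk]
      exact ⟨hq n, fun h => by rw [le_antisymm h hk]⟩
    · have hqk := hq (k + 1)
      have ht := div_pos ih.1 hqk
      have hc : 0 < ⌈ceilRem q n k / q (k + 1)⌉₊ := Nat.ceil_pos.2 ht
      have h1 := Nat.ceil_lt_add_one ht.le
      have h2 := Nat.le_ceil (ceilRem q n k / q (k + 1))
      have hd : ((ceilDigit q n k : ℕ) : ℝ) = (⌈ceilRem q n k / q (k + 1)⌉₊ : ℝ) - 1 := by
        rw [ceilDigit, if_neg (by omega), Nat.cast_sub hc, Nat.cast_one]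
      rw [ceilRem_succ, hd]
      rw [← sub_lt_iff_lt_add, lt_div_iff₀ hqk] at h1
      rw [div_le_iff₀ hqk] at h2
      exact ⟨by linarith, fun _ => by linarith⟩

lemma tendsto_ceilRem (hq : ∀ k, 0 < q k) (h0 : Filter.Tendsto q Filter.atTop (nhds 0)) (n : ℕ) :
    Filter.Tendsto (ceilRem q n) Filter.atTop (nhds 0) := by
  refine squeeze_zero' (.of_forall fun k => (ceilRem_bounds hq n k).1.le) ?_ h0
  filter_upwards [Filter.eventually_ge_atTop n] with k hk using (ceilRem_bounds hq n k).2 hk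

/-- Strict decrease makes the leading digit positive. If the digits vanished eventually, a positive
remainder would freeze, yet remainders tend to 0. -/
lemma isProper_ceilDigit (hq : ∀ k, 0 < q k) (hanti : StrictAnti q)
    (h0 : Filter.Tendsto q Filter.atTop (nhds 0)) : IsProper (ceilDigit q) := by
  refine ⟨fun n k hk => if_pos hk, fun n => ?_, fun n m => ?_⟩
  · rw [ceilDigit, if_neg (lt_irrefl n), ceilRem_of_le le_rfl]
    have h1 : (1 : ℕ) < q n / q (n + 1) := by
      rw [Nat.cast_one, one_lt_div (hq _)]
      exact hanti n.lt_succ_self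
    have := Nat.lt_ceil.2 h1
    omega
  · by_contra! hc
    have hconst : ∀ k, m ≤ k → ceilRem q n k = ceilRem q n m := by
      intro k hk
      induction k, hk using Nat.le_induction with
      | base => rfl
      | succ k hk ih => rw [ceilRem_succ, ih, Nat.le_zero.1 (hc k hk)]; simp
    have : Filter.Tendsto (ceilRem q n) Filter.atTop (nhds (ceilRem q n m)) :=
      tendsto_const_nhds.congr' (by
        filter_upwards [Filter.eventually_ge_atTop m] with k hk using (hconst k hk).symm)
    exact (ceilRem_bounds hq n m).1.ne (tendsto_nhds_unique (tendsto_ceilRem hq h0 n) this)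

lemma hasSum_of_tendsto_psum (hq : ∀ k, 0 < q k) {ε : ℕ → ℕ} {a : ℝ}
    (h : Filter.Tendsto (psum q ε) Filter.atTop (nhds a)) :
    HasSum (fun k => (ε k : ℝ) * q (k + 1)) a :=
  (hasSum_iff_tendsto_nat_of_nonneg (fun _ => mul_nonneg (Nat.cast_nonneg _) (hq _).le) _).2 h

lemma hasSum_ceilDigit (hq : ∀ k, 0 < q k) (h0 : Filter.Tendsto q Filter.atTop (nhds 0)) (n : ℕ) :
    HasSum (fun k => (ceilDigit q n k : ℝ) * q (k + 1)) (q n) := by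
  refine hasSum_of_tendsto_psum hq ?_
  have := (tendsto_ceilRem hq h0 n).const_sub (q n)
  rw [sub_zero] at this
  exact this.congr fun m => (psum_ceilDigit n m).symm

end CeilExpansion

/-! ### Periodic maximal functions and the linear recursion -/

section Periodic

variable {N : ℕ} {e : ℕ → ℕ}

/-- The period `e₁, …, e_{N-1}, e_N - 1`. -/
def periodDigit (N : ℕ) (e : ℕ → ℕ) (r : ℕ) : ℕ := if r + 1 = N then e N - 1 else e (r + 1)

/-- The periodic block maxima, indexed from `0`. -/
def periodic (N : ℕ) (e : ℕ → ℕ) (n k : ℕ) : ℕ :=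
  if k < n then 0 else periodDigit N e ((k - n) % N)

lemma isProper_periodic (hN : 1 ≤ N) (h1 : 0 < e 1) (hL : ¬(N = 1 ∧ e 1 = 1)) :
    IsProper (periodic N e) := by
  have h0 : 0 < periodDigit N e 0 := by
    unfold periodDigit
    split_ifs with h
    · have : N = 1 := by omega
      subst this
      omega
    · simpa using h1
  refine ⟨fun n k hk => if_pos hk, fun n => ?_, fun n m => ⟨n + m * N, ?_, ?_⟩⟩
  · simpa [periodic] using h0
  · nlinarith
  · simpa [periodic] using h0

/-- The unit removed from the last digit of a period is what the following periods have to make up.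
-/
lemma sum_periodDigit (hN : 1 ≤ N) (heN : 0 < e N) (m : ℕ) :
    ∑ i ∈ Finset.range N, (periodDigit N e i : ℝ) * q (m + i + 1) =
      ∑ i ∈ Finset.range N, (e (i + 1) : ℝ) * q (m + i + 1) - q (m + N) := by
  obtain ⟨N, rfl⟩ := Nat.exists_eq_add_of_le' hN
  rw [Finset.sum_range_succ, Finset.sum_range_succ, Finset.sum_congr rfl fun i hi => ?_]
  · rw [periodDigit, if_pos rfl, Nat.cast_sub heN, Nat.cast_one, ← add_assoc]
    ring
  · rw [periodDigit, if_neg (by have := Finset.mem_range.1 hi; omega)]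

lemma psum_periodic_self (n : ℕ) : psum q (periodic N e n) n = 0 :=
  psum_eq_zero fun _ hk => if_pos hk

lemma psum_periodic_add (n m : ℕ) :
    psum q (periodic N e n) (n + m * N + N) = psum q (periodic N e n) (n + m * N) +
      ∑ i ∈ Finset.range N, (periodDigit N e i : ℝ) * q (n + m * N + i + 1) := by
  rw [psum, Finset.sum_range_add]
  refine congrArg _ (Finset.sum_congr rfl fun i hi => ?_)
  have : (n + m * N + i - n) % N = i := by
    rw [show n + m * N + i - n = i + m * N by omega, Nat.add_mul_mod_self_right,
      Nat.mod_eq_of_lt (Finset.mem_range.1 hi)]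
  rw [periodic, if_neg (by omega), this]

/-- The full recursion of the periodic block maxima implies the linear recursion. -/
lemma eq_sum_of_hasSum_periodic (hN : 1 ≤ N) (heN : 0 < e N)
    (h : ∀ n, HasSum (fun k => (periodic N e n k : ℝ) * q (k + 1)) (q n)) (n : ℕ) :
    q n = ∑ i ∈ Finset.range N, (e (i + 1) : ℝ) * q (n + i + 1) := by
  have e1 := (h n).summable.sum_add_tsum_nat_add (n + N)
  have e2 := (h (n + N)).summable.sum_add_tsum_nat_add (n + N)
  change psum q (periodic N e n) (n + N) + _ = _ at e1
  change psum q (periodic N e (n + N)) (n + N) + _ = _ at e2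
  rw [(h _).tsum_eq] at e1 e2
  rw [psum_periodic_self] at e2
  have e3 := psum_periodic_add (N := N) (e := e) (q := q) n 0
  rw [zero_mul, add_zero, psum_periodic_self,
    sum_periodDigit hN heN] at e3
  -- From `n + N` on, the maximal functions of `n` and `n + N` coincide, so the tail is worth `q (n
  -- + N)`.
  have e4 : (∑' k, (periodic N e n (k + (n + N)) : ℝ) * q (k + (n + N) + 1)) =
      ∑' k, (periodic N e (n + N) (k + (n + N)) : ℝ) * q (k + (n + N) + 1) := by
    refine tsum_congr fun k => ?_
    rw [periodic, periodic, if_neg (by omega), if_neg (by omega),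
      show k + (n + N) - n = k + N by omega, Nat.add_mod_right,
      show k + (n + N) - (n + N) = k by omega]
  linarith

/-- Over whole periods the partial sums telescope to `q n - q (n + m * N)`; being monotone, they
converge once this subsequence does. -/
lemma hasSum_periodic_of_eq_sum (hN : 1 ≤ N) (heN : 0 < e N) (hq : ∀ k, 0 < q k)
    (h0 : Filter.Tendsto q Filter.atTop (nhds 0))
    (h : ∀ n, q n = ∑ i ∈ Finset.range N, (e (i + 1) : ℝ) * q (n + i + 1)) (n : ℕ) :
    HasSum (fun k => (periodic N e n k : ℝ) * q (k + 1)) (q n) := by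
  have hp : ∀ m, psum q (periodic N e n) (n + m * N) = q n - q (n + m * N) := by
    intro m
    induction m with
    | zero => rw [zero_mul, add_zero, psum_periodic_self, sub_self]
    | succ m ih =>
      rw [show n + (m + 1) * N = n + m * N + N by ring, psum_periodic_add, ih,
        sum_periodDigit hN heN, ← h]
      ring
  have hsub : Filter.Tendsto (fun m : ℕ => n + m * N) Filter.atTop Filter.atTop :=
    Filter.tendsto_atTop_mono (fun m => by
      change m ≤ n + m * N
      nlinarith) Filter.tendsto_id
  refine hasSum_of_tendsto_psum hq
    ((tendsto_iff_tendsto_subseq_of_monotone (psum_mono hq) hsub).2 ?_)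
  have := (h0.comp hsub).const_sub (q n)
  rw [sub_zero] at this
  exact this.congr fun m => (hp m).symm

end Periodic

/-! ### Positive solutions of the linear recursion -/

section Harmonic

variable {N : ℕ} {p r : ℕ → ℝ}

/-- A solution of a mean value recursion does not exceed the maximum of any later window. -/
lemma exists_le_of_mean (hN : 1 ≤ N) (hp : ∀ j, 0 ≤ p j) (hp0 : 0 < p 0)
    (hsum : ∑ j ∈ Finset.range N, p j = 1)
    (h : ∀ n, r n = ∑ j ∈ Finset.range N, p j * r (n + j + 1)) (n : ℕ) :
    ∃ j < N, r 0 ≤ r (n + j) := by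
  by_contra! hc
  -- Backward induction: a window of values below `r 0` forces the preceding value below it, until
  -- the window contains `r 0` itself.
  have key : ∀ n, (∀ j < N, r (n + j) < r 0) → r 0 < r 0 := by
    intro n
    induction n with
    | zero => exact fun h => by simpa using h 0 hN
    | succ n ih =>
      refine fun hw => ih fun j hj => ?_
      rcases j with _ | j
      · calc r (n + 0) = ∑ j ∈ Finset.range N, p j * r (n + j + 1) := h n
          _ < ∑ j ∈ Finset.range N, p j * r 0 := by
            have hlt : ∀ j ∈ Finset.range N, r (n + j + 1) < r 0 := fun j hj => by
              have := hw j (Finset.mem_range.1 hj)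
              rwa [show n + 1 + j = n + j + 1 by ring] at this
            refine Finset.sum_lt_sum (fun j hj => mul_le_mul_of_nonneg_left (hlt j hj).le (hp j))
              ⟨0, Finset.mem_range.2 hN, mul_lt_mul_of_pos_left (hlt 0 (Finset.mem_range.2 hN)) hp0⟩
          _ = r 0 := by rw [← Finset.sum_mul, hsum, one_mul]
      · have := hw j (by omega)
        rwa [show n + 1 + j = n + (j + 1) by ring] at this
  exact lt_irrefl _ (key n hc)

/-- A non-negative solution of a mean value recursion is constant. -/
lemma eq_const_of_mean (hN : 1 ≤ N) (hp : ∀ j, 0 ≤ p j) (hp0 : 0 < p 0)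
    (hsum : ∑ j ∈ Finset.range N, p j = 1) (hr : ∀ n, 0 ≤ r n)
    (h : ∀ n, r n = ∑ j ∈ Finset.range N, p j * r (n + j + 1)) (n : ℕ) : r n = r 0 := by
  have hbdd : BddBelow (Set.range r) := ⟨0, by rintro _ ⟨n, rfl⟩; exact hr n⟩
  -- Subtracting the infimum leaves a non-negative solution `s` of infimum 0; a Harnack-type bound
  -- of `s` from below by a multiple of `s 0` then forces `s 0 = 0`.
  set m := ⨅ n, r n with hm
  set s : ℕ → ℝ := fun n => r n - m with hs
  have hs0 : ∀ n, 0 ≤ s n := fun n => sub_nonneg.2 (ciInf_le hbdd n)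
  have hsrec : ∀ n, s n = ∑ j ∈ Finset.range N, p j * s (n + j + 1) := fun n => by
    simp only [hs, mul_sub]
    rw [Finset.sum_sub_distrib, ← Finset.sum_mul, hsum, one_mul, ← h]
  have hstep : ∀ n, p 0 * s (n + 1) ≤ s n := fun n => by
    rw [hsrec n]
    exact Finset.single_le_sum (f := fun j => p j * s (n + j + 1))
      (fun j _ => mul_nonneg (hp j) (hs0 _)) (Finset.mem_range.2 hN)
  have hpow : ∀ n j, p 0 ^ j * s (n + j) ≤ s n := by
    intro n j
    induction j with
    | zero => simp
    | succ j ih =>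
      refine le_trans ?_ ih
      rw [pow_succ, mul_assoc]
      exact mul_le_mul_of_nonneg_left (hstep _) (pow_nonneg hp0.le _)
  have hp1 : p 0 ≤ 1 := by
    rw [← hsum]
    exact Finset.single_le_sum (fun j _ => hp j) (Finset.mem_range.2 hN)
  -- Some value at least `s 0` occurs fewer than `N` steps after `n`, and each step back costs at
  -- most a factor `p 0`.
  have hlow : ∀ n, p 0 ^ N * s 0 ≤ s n := by
    intro n
    obtain ⟨j, hj, hle⟩ := exists_le_of_mean hN hp hp0 hsum hsrec n
    calc p 0 ^ N * s 0 ≤ p 0 ^ j * s (n + j) :=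
          mul_le_mul (pow_le_pow_of_le_one hp0.le hp1 hj.le) hle (hs0 0) (pow_nonneg hp0.le _)
      _ ≤ s n := hpow n j
  have hz0 : s 0 = 0 := by
    have : p 0 ^ N * s 0 + m ≤ m := le_ciInf fun n => by
      have := hlow n
      simp only [hs] at this ⊢
      linarith
    have h2 : 0 < p 0 ^ N := pow_pos hp0 _
    have h3 := hs0 0
    nlinarith
  have hz : ∀ n, s n = 0 := by
    intro n
    induction n with
    | zero => exact hz0
    | succ n ih =>
      have h1 := hstep n
      have h2 := hs0 (n + 1)
      rw [ih] at h1
      nlinarith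
  have h1 := hz n
  simp only [hs] at h1 hz0
  linarith

/-- The positive solutions of the linear recursion are geometric. -/
lemma eq_pow_of_linear_recursion {e : ℕ → ℕ} {ω : ℝ} (hN : 1 ≤ N) (h1 : 0 < e 1) (hω : 0 < ω)
    (hroot : ∑ j ∈ Finset.range N, (e (j + 1) : ℝ) * ω ^ (j + 1) = 1) {q : ℕ → ℝ}
    (hq : ∀ k, 0 < q k) (hq0 : q 0 = 1)
    (h : ∀ n, q n = ∑ i ∈ Finset.range N, (e (i + 1) : ℝ) * q (n + i + 1)) (n : ℕ) :
    q n = ω ^ n := by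
  -- After division by `ω ^ n` the weights sum to 1, because `ω` is a root.
  have := eq_const_of_mean (p := fun j => (e (j + 1) : ℝ) * ω ^ (j + 1))
    (r := fun n => q n / ω ^ n) hN (fun j => by positivity)
    (by have : (0 : ℝ) < e 1 := by exact_mod_cast h1
        simpa using mul_pos this hω) hroot
    (fun n => div_nonneg (hq n).le (pow_nonneg hω.le _)) (fun n => by
      rw [h n, Finset.sum_div]
      refine Finset.sum_congr rfl fun j _ => ?_
      rw [add_assoc n j 1]
      field_simp
      ring) n
  rwa [hq0, pow_zero, div_one, div_eq_one_iff_eq (pow_ne_zero _ hω.ne')] at this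

/-- The sum vanishes at 0, increases strictly on `[0, ∞)` since `e 1 > 0`, and exceeds 1 at 1,
because the excluded list is the only one whose entries sum to 1. -/
lemma exists_root {e : ℕ → ℕ} (hN : 1 ≤ N) (h1 : 0 < e 1) (heN : 0 < e N)
    (hL : ¬(N = 1 ∧ e 1 = 1)) : ∃ ω : ℝ, 0 < ω ∧ ω < 1 ∧
      ∀ x : ℝ, (0 < x ∧ ∑ j ∈ Finset.range N, (e (j + 1) : ℝ) * x ^ (j + 1) = 1) ↔ x = ω := by
  set f : ℝ → ℝ := fun x => ∑ j ∈ Finset.range N, (e (j + 1) : ℝ) * x ^ (j + 1) with hf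
  have hf0 : f 0 = 0 := by simp [hf]
  have hf1 : 1 < f 1 := by
    have : 1 < ∑ j ∈ Finset.range N, e (j + 1) := by
      obtain ⟨N, rfl⟩ := Nat.exists_eq_add_of_le' hN
      rw [Finset.sum_range_succ]
      rcases Nat.eq_zero_or_pos N with rfl | hpos
      · simp at hL ⊢
        omega
      · have := Finset.single_le_sum (f := fun j => e (j + 1)) (fun j _ => Nat.zero_le _)
          (Finset.mem_range.2 hpos)
        simp only [zero_add] at this
        omega
    simp only [hf, one_pow, mul_one]
    exact_mod_cast this
  have hmono : StrictMonoOn f (Set.Ici 0) := by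
    intro x hx y hy hxy
    refine Finset.sum_lt_sum (fun j _ => mul_le_mul_of_nonneg_left
      (pow_le_pow_left₀ hx hxy.le _) (Nat.cast_nonneg _)) ⟨0, Finset.mem_range.2 hN, ?_⟩
    have : (0 : ℝ) < e 1 := by exact_mod_cast h1
    simpa using mul_lt_mul_of_pos_left hxy this
  have hcont : Continuous f := by fun_prop
  obtain ⟨ω, ⟨hω0, hω1⟩, hω⟩ := intermediate_value_Ioo (zero_le_one' ℝ) hcont.continuousOn
    (show (1 : ℝ) ∈ Set.Ioo (f 0) (f 1) from ⟨by rw [hf0]; exact one_pos, hf1⟩)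
  refine ⟨ω, hω0, hω1, fun x => ⟨fun hx => ?_, fun hx => hx ▸ ⟨hω0, hω⟩⟩⟩
  exact hmono.injOn hx.1.le hω0.le (hx.2.trans hω.symm)

lemma sum_Icc_one_eq (f : ℕ → ℝ) (N : ℕ) :
    ∑ k ∈ Finset.Icc 1 N, f k = ∑ j ∈ Finset.range N, f (j + 1) := by
  induction N with
  | zero => simp
  | succ N ih => rw [Finset.sum_Icc_succ_top (by omega), ih, Finset.sum_range_succ]

end Harmonic

end BlockLang

/-! ### Assembly of the three statements -/

namespace Coeff

variable {b : ℕ+ → Coeff} {Q : ℕ+ → ℝ}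

lemma order_infSupport_of_isProper (h : BlockLang.IsProper (shiftFamily b)) (n : ℕ+) :
    HasOrder (b n) n ∧ InfSupport (b n) := by
  have hsh : ∀ k : ℕ+, shiftFamily b n.natPred k.natPred = b n k := fun k => by
    simp [shiftFamily]
  refine ⟨⟨?_, fun k hk => ?_⟩, Set.infinite_of_forall_exists_gt fun m => ?_⟩
  · have := h.pos n.natPred
    rw [hsh] at this
    exact this.ne'
  · by_contra! hlt
    have := h.zero_before n.natPred k.natPred (PNat.natPred_lt_natPred.2 hlt)
    rw [hsh] at this
    exact hk this
  · obtain ⟨k, hk, hpos⟩ := h.exists_pos n.natPred m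
    refine ⟨k.succPNat, ?_, ?_⟩
    · have := hsh k.succPNat
      rw [Nat.natPred_succPNat] at this
      rw [Set.mem_ofPred_eq, ← this]
      exact hpos.ne'
    · rw [← PNat.coe_lt_coe, Nat.succPNat_coe]
      exact Nat.lt_succ_of_le hk

lemma shiftFamily_listMax (N : ℕ) (e : ℕ → ℕ) :
    shiftFamily (listMax N e) = BlockLang.periodic N e := by
  ext n k
  simp only [shiftFamily, listMax, BlockLang.periodic, BlockLang.periodDigit,
    Nat.succPNat_lt_succPNat, Nat.succPNat_coe, Nat.succ_sub_succ]

lemma exists_fullRecursion (hanti : StrictAnti Q) (hQ : ∀ k, Q k ∈ Set.Ioo (0 : ℝ) 1)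
    (h0 : Filter.Tendsto Q Filter.atTop (nhds 0)) :
    ∃ μ : ℕ+ → Coeff, (∀ n, HasOrder (μ n) n ∧ InfSupport (μ n)) ∧ FullRecursion μ Q := by
  have hpos := withOne_pos fun k => (hQ k).1
  have hanti' := withOne_strictAnti hanti fun k => (hQ k).2
  have hlim : Filter.Tendsto (withOne Q) Filter.atTop (nhds 0) := by
    rw [← Filter.tendsto_add_atTop_iff_nat 1]
    simp only [withOne_succ]
    refine h0.comp (Filter.tendsto_atTop_atTop.2 fun m => ⟨m, fun k hk => ?_⟩)
    rw [← PNat.coe_le_coe, Nat.succPNat_coe]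
    omega
  set μ : ℕ+ → Coeff := fun n k => BlockLang.ceilDigit (withOne Q) n.natPred k.natPred with hμ
  have hsh : shiftFamily μ = BlockLang.ceilDigit (withOne Q) := by
    ext n k
    simp [shiftFamily, hμ]
  refine ⟨μ, order_infSupport_of_isProper ?_, fullRecursion_iff.2 ?_⟩
  · rw [hsh]
    exact BlockLang.isProper_ceilDigit hpos hanti' hlim
  · rw [hsh]
    exact BlockLang.hasSum_ceilDigit hpos hlim

lemma fullRecursion_listMax_iff {N : ℕ} {e : ℕ → ℕ} {ω : ℝ} (hN : 1 ≤ N) (h1 : 0 < e 1)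
    (heN : 0 < e N) (hω : 0 < ω) (hω1 : ω < 1)
    (hroot : ∑ j ∈ Finset.range N, (e (j + 1) : ℝ) * ω ^ (j + 1) = 1) (hQ : ∀ k, 0 < Q k) :
    FullRecursion (listMax N e) Q ↔ ∀ k : ℕ+, Q k = ω ^ (k : ℕ) := by
  have hpos := withOne_pos hQ
  rw [fullRecursion_iff, shiftFamily_listMax]
  refine ⟨fun h k => ?_, fun h => ?_⟩
  · have := BlockLang.eq_pow_of_linear_recursion hN h1 hω hroot hpos withOne_zero
      (BlockLang.eq_sum_of_hasSum_periodic hN heN h) (k.natPred + 1)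
    rwa [withOne_succ, PNat.succPNat_natPred, PNat.natPred_add_one] at this
  · have hpow : withOne Q = fun n => ω ^ n := by
      ext n
      cases n with
      | zero => rw [withOne_zero, pow_zero]
      | succ n => rw [withOne_succ, h]; rfl
    refine BlockLang.hasSum_periodic_of_eq_sum hN heN hpos ?_ ?_
    · rw [hpow]
      exact tendsto_pow_atTop_nhds_zero_of_lt_one hω.le hω1
    · intro n
      simp only [hpow]
      calc ω ^ n = ω ^ n * ∑ j ∈ Finset.range N, (e (j + 1) : ℝ) * ω ^ (j + 1) := by
            rw [hroot, mul_one]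
        _ = _ := by
            rw [Finset.mul_sum]
            exact Finset.sum_congr rfl fun j _ => by ring

end Coeff

theorem mainTheorem6 :
    -- Part 1 (a)
    (∀ Q : ℕ+ → ℝ, StrictAnti Q → (∀ k, Q k ∈ Set.Ioo (0 : ℝ) 1) →
      Filter.Tendsto Q Filter.atTop (nhds 0) →
      ∃ μ : ℕ+ → Coeff, (∀ n, Coeff.HasOrder (μ n) n ∧ Coeff.InfSupport (μ n)) ∧
        Coeff.FullRecursion μ Q) ∧
    -- Part 1 (b)
    (∀ Q : ℕ+ → ℝ, StrictAnti Q → (∀ k, Q k ∈ Set.Ioo (0 : ℝ) 1) →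
      ∀ E : Set Coeff, Coeff.IsZeckendorf E →
      ∀ b : ℕ+ → Coeff, (∀ n, Coeff.IsMaximal E n (b n)) →
        (Coeff.IsFundamental E (Set.Ioo 0 1) Q ↔ Coeff.FullRecursion b Q)) ∧
    -- Part 2
    (∀ (N : ℕ) (e : ℕ → ℕ), 1 ≤ N → 0 < e 1 → 0 < e N → ¬(N = 1 ∧ e 1 = 1) →
      ∃ ω : ℝ,
        (∀ x : ℝ, (0 < x ∧ ∑ k ∈ Finset.Icc 1 N, (e k : ℝ) * x ^ k - 1 = 0) ↔ x = ω) ∧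
        (∃ Q : ℕ+ → ℝ,
          Coeff.IsFundamental (Coeff.determinedBy (Coeff.listMax N e)) (Set.Ioo 0 1) Q) ∧
        ∀ Q : ℕ+ → ℝ,
          (StrictAnti Q ∧
            Coeff.IsFundamental (Coeff.determinedBy (Coeff.listMax N e)) (Set.Ioo 0 1) Q) ↔
          ∀ k : ℕ+, Q k = ω ^ (k : ℕ)) := by
  refine ⟨fun Q hanti hQ h0 => Coeff.exists_fullRecursion hanti hQ h0,
    fun Q hanti hQ E hE b hb => ?_, fun N e hN h1 heN hL => ?_⟩
  · rw [hE.eq_determinedBy hb]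
    exact Coeff.isFundamental_determinedBy_iff (fun n => ⟨(hb n).order, (hb n).infinite⟩) hanti hQ
  · obtain ⟨ω, hω0, hω1, hω⟩ := BlockLang.exists_root hN h1 heN hL
    have hb := Coeff.order_infSupport_of_isProper (b := Coeff.listMax N e) (by
      rw [Coeff.shiftFamily_listMax]
      exact BlockLang.isProper_periodic hN h1 hL)
    have hroot := ((hω ω).2 rfl).2
    have hpow : ∀ Q : ℕ+ → ℝ, (StrictAnti Q ∧
        Coeff.IsFundamental (Coeff.determinedBy (Coeff.listMax N e)) (Set.Ioo 0 1) Q) ↔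
        ∀ k : ℕ+, Q k = ω ^ (k : ℕ) := by
      intro Q
      constructor
      · rintro ⟨hanti, hf⟩
        rw [← Coeff.fullRecursion_listMax_iff hN h1 heN hω0 hω1 hroot fun k => (hf.1 k).1]
        exact (Coeff.isFundamental_determinedBy_iff hb hanti hf.1).1 hf
      · intro hQ
        have hanti : StrictAnti Q := fun k l hkl => by
          rw [hQ, hQ]
          exact pow_lt_pow_right_of_lt_one₀ hω0 hω1 hkl
        have hI : ∀ k, Q k ∈ Set.Ioo (0 : ℝ) 1 := fun k => by
          rw [hQ]
          exact ⟨pow_pos hω0 _, pow_lt_one₀ hω0.le hω1 k.ne_zero⟩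
        refine ⟨hanti, (Coeff.isFundamental_determinedBy_iff hb hanti hI).2 ?_⟩
        exact (Coeff.fullRecursion_listMax_iff hN h1 heN hω0 hω1 hroot fun k => (hI k).1).2 hQ
    refine ⟨ω, fun x => ?_, ⟨fun k => ω ^ (k : ℕ), ((hpow _).2 fun _ => rfl).2⟩, hpow⟩
    rw [BlockLang.sum_Icc_one_eq (fun k => (e k : ℝ) * x ^ k), sub_eq_zero]
    exact hω x
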